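/- Let $N\in\{2,3\}$, $\alpha=4-N$, let $m_1,m_2>0$ and let $\omega\in\mathbb R$ satisfy $\omega^2<\min\{m_1^2,\,m_2^2/4\}$. All functions are complex valued; $\|\cdot\|$ is the norm of $L^2(\mathbb R^N)$ and $(f,g)_{L^2}=\mathrm{Re}\int_{\mathbb R^N} f\,\overline{g}\,dx$. For $\vec u=(u_1,u_2)\in H^1(\mathbb R^N)^2$ and $\vec v=(v_1,v_2)\in L^2(\mathbb R^N)^2$, that is, $(\vec u,\vec v)\in X=H^1(\mathbb R^N)^2\times L^2(\mathbb R^N)^2$, put $$G(\vec u)=\mathrm{Re}\int_{\mathbb R^N}u_1^2\,\overline{u_2}\,dx,\qquad L(\vec u)=-\tfrac12\sum_{j=1}^2\|\nabla u_j\|^2+G(\vec u),$$ $$K(\vec v)=\tfrac12\sum_{j=1}^2\|v_j\|^2,\qquad M(\vec u)=\tfrac12\sum_{j=1}^2m_j^2\|u_j\|^2,$$ $$E(\vec u,\vec v)=\tfrac12\sum_{j=1}^2\bigl(\|v_j\|^2+\|\nabla u_j\|^2+m_j^2\|u_j\|^2\bigr)-G(\vec u),$$ $$Q(\vec u,\vec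 v)=(v_1,iu_1)_{L^2}+2(v_2,iu_2)_{L^2},$$ $$H(\vec u,\vec v)=-\alpha K(\vec v)+\alpha M(\vec u)-(\alpha+2)L(\vec u),$$ $$M_\omega(\vec u)=\tfrac{m_1^2-\omega^2}{2}\|u_1\|^2+\tfrac{m_2^2-4\omega^2}{2}\|u_2\|^2,\qquad J_\omega=M_\omega-L,\qquad P_\omega=\alpha M_\omega-(\alpha+2)L.$$ Let $\mathcal N_\omega$ be the set of all $\vec u\in H^1(\mathbb R^N)^2\setminus\{\vec 0\}$ with $J_\omega'(\vec u)=0$, and let a ground state be an element $\vec\phi\in\mathcal N_\omega$ with $J_\omega(\vec\phi)\le J_\omega(\vec u)$ for all $\vec u\in\mathcal N_\omega$. Let $\vec\phi_\omega=(\phi_{1,\omega},\phi_{2,\omega})$ be a radially symmetric ground state, put $\vec\psi_\omega=(i\omega\phi_{1,\omega},\,2i\omega\phi_{2,\omega})$, and assume $$\bigl\{m_1^2-(5-N)\omega^2\bigr\}\|\phi_{1,\omega}\|^2+\bigl\{m_2^2-4(5-N)\omega^2\bigr\}\|\phi_{2,\omega}\|^2\ge0.$$ If $(\vec u,\vec v)\in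 X$ satisfies $$H(\vec u,\vec v)\le0,\qquad Q(\vec u,\vec v)=Q(\vec\phi_\omega,\vec\psi_\omega),\qquad P_\omega(\vec u)<0,$$ then $$\alpha E(\vec\phi_\omega,\vec\psi_\omega)\le\alpha E(\vec u,\vec v)-H(\vec u,\vec v).$$ -/

import Mathlib

open MeasureTheory
open scoped ComplexConjugate

noncomputable section

namespace KleinGordon

/-- The physical space `ℝ^N`. -/
abbrev Space (N : ℕ) := EuclideanSpace ℝ (Fin N)

/-- The complex space `L²(ℝ^N)`. -/
abbrev L2 (N : ℕ) := Lp ℂ 2 (volume : Measure (Space N))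

/-- The space `L²(ℝ^N; ℂ^N)` of square-integrable complex vector fields. -/
abbrev L2Vec (N : ℕ) := Lp (EuclideanSpace ℂ (Fin N)) 2 (volume : Measure (Space N))

/-- `g` is the weak gradient of `f`: for every test function `η ∈ C_c^∞(ℝ^N)` and every `j`,
`∫ (∂_j η) f = - ∫ η g_j`. -/
def IsWeakGradient {N : ℕ} (f : Space N → ℂ) (g : Space N → EuclideanSpace ℂ (Fin N)) : Prop :=
  ∀ η : Space N → ℝ, ContDiff ℝ (⊤ : ℕ∞) η → HasCompactSupport η → ∀ j : Fin N,
    ∫ x, (fderiv ℝ η x (EuclideanSpace.single j 1)) • f x = - ∫ x, η x • g x j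

theorem integrable_smul_of_L2 {N : ℕ} {η : Space N → ℝ} (hη : Continuous η)
    (hc : HasCompactSupport η) {f : Space N → ℂ} (hf : MemLp f 2 volume) :
    Integrable (fun x => η x • f x) volume :=
  memLp_one_iff_integrable.1 (hf.smul (hη.memLp_of_hasCompactSupport hc (p := 2)))

theorem integrable_fderiv_smul_of_L2 {N : ℕ} {η : Space N → ℝ} (hη : ContDiff ℝ (⊤ : ℕ∞) η)
    (hc : HasCompactSupport η) (j : Fin N) {f : Space N → ℂ} (hf : MemLp f 2 volume) :
    Integrable (fun x => (fderiv ℝ η x (EuclideanSpace.single j 1)) • f x) volume :=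
  integrable_smul_of_L2 ((hη.continuous_fderiv (by simp)).clm_apply continuous_const)
    (hc.fderiv_apply ℝ _) hf

theorem memLp_coord {N : ℕ} (g : L2Vec N) (j : Fin N) :
    MemLp (fun x => g x j) 2 (volume : Measure (Space N)) :=
  (EuclideanSpace.proj j : EuclideanSpace ℂ (Fin N) →L[ℂ] ℂ).comp_memLp' (Lp.memLp g)

/-- The complex Sobolev space `H¹(ℝ^N)`, realised as the space of all pairs `(f, ∇f)` with
`f ∈ L²(ℝ^N)` and weak gradient `∇f ∈ L²(ℝ^N; ℂ^N)`. The norm inherited from the `ℓ²`-product is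
the usual one: `‖f‖_{H¹}² = ‖f‖_{L²}² + ‖∇f‖_{L²}²`. -/
def H1 (N : ℕ) : Submodule ℂ (WithLp 2 (L2 N × L2Vec N)) where
  carrier := {p | IsWeakGradient p.fst p.snd}
  zero_mem' := by
    intro η _ _ j
    have h1 : ∫ x, (fderiv ℝ η x (EuclideanSpace.single j 1)) • (0 : L2 N) x = 0 := by
      simp
    have h2 : ∫ x, η x • (0 : L2Vec N) x j = 0 := by
      simp
    rw [WithLp.zero_fst, WithLp.zero_snd, h1, h2, neg_zero]
  add_mem' := by
    intro p q hp hq η hη hc j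
    have h1 : ∫ x, (fderiv ℝ η x (EuclideanSpace.single j 1)) • (p.fst + q.fst : L2 N) x
        = (∫ x, (fderiv ℝ η x (EuclideanSpace.single j 1)) • p.fst x)
          + ∫ x, (fderiv ℝ η x (EuclideanSpace.single j 1)) • q.fst x := by
      rw [← integral_add (integrable_fderiv_smul_of_L2 hη hc j (Lp.memLp _))
        (integrable_fderiv_smul_of_L2 hη hc j (Lp.memLp _))]
      apply integral_congr_ae
      filter_upwards [Lp.coeFn_add p.fst q.fst] with x hx
      rw [hx, Pi.add_apply, smul_add]
    have h2 : ∫ x, η x • (p.snd + q.snd : L2Vec N) x j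
        = (∫ x, η x • p.snd x j) + ∫ x, η x • q.snd x j := by
      rw [← integral_add (integrable_smul_of_L2 hη.continuous hc (memLp_coord _ j))
        (integrable_smul_of_L2 hη.continuous hc (memLp_coord _ j))]
      apply integral_congr_ae
      filter_upwards [Lp.coeFn_add p.snd q.snd] with x hx
      rw [hx, Pi.add_apply, PiLp.add_apply, smul_add]
    rw [WithLp.add_fst, WithLp.add_snd, h1, h2, hp η hη hc j, hq η hη hc j, neg_add]
  smul_mem' := by
    intro c p hp η hη hc j
    have h1 : ∫ x, (fderiv ℝ η x (EuclideanSpace.single j 1)) • (c • p.fst : L2 N) x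
        = c • ∫ x, (fderiv ℝ η x (EuclideanSpace.single j 1)) • p.fst x := by
      rw [← integral_smul]
      apply integral_congr_ae
      filter_upwards [Lp.coeFn_smul c p.fst] with x hx
      rw [hx, Pi.smul_apply, smul_comm]
    have h2 : ∫ x, η x • (c • p.snd : L2Vec N) x j = c • ∫ x, η x • p.snd x j := by
      rw [← integral_smul]
      apply integral_congr_ae
      filter_upwards [Lp.coeFn_smul c p.snd] with x hx
      rw [hx, Pi.smul_apply, PiLp.smul_apply, smul_comm]
    rw [WithLp.smul_fst, WithLp.smul_snd, h1, h2, hp η hη hc j, smul_neg]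

/-- The `L²` function underlying an element of `H¹`. -/
def fn {N : ℕ} (u : H1 N) : L2 N := u.1.fst

/-- The weak gradient of an element of `H¹`. -/
def grad {N : ℕ} (u : H1 N) : L2Vec N := u.1.snd

/-- `H¹(ℝ^N)²`. -/
abbrev H1Pair (N : ℕ) := H1 N × H1 N

/-- `L²(ℝ^N)²`. -/
abbrev L2Pair (N : ℕ) := L2 N × L2 N

/-- The energy space `X = H¹(ℝ^N)² × L²(ℝ^N)²`. -/
abbrev EnergySpace (N : ℕ) := H1Pair N × L2Pair N

/-- The exponent `α = 4 - N` (a real number, no truncation). -/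
def alpha (N : ℕ) : ℝ := 4 - (N : ℝ)

/-- `(f, g)_{L²} = Re ∫ f \bar g`. -/
def l2Inner {N : ℕ} (f g : L2 N) : ℝ := (∫ x, f x * conj (g x)).re

/-- `G(u) = Re ∫ u₁² \bar u₂`. -/
def G {N : ℕ} (u : H1Pair N) : ℝ := (∫ x, ((fn u.1) x) ^ 2 * conj ((fn u.2) x)).re

/-- The energy `E`. -/
def E {N : ℕ} (m₁ m₂ : ℝ) (w : EnergySpace N) : ℝ :=
  1 / 2 * ((‖w.2.1‖ ^ 2 + ‖grad w.1.1‖ ^ 2 + m₁ ^ 2 * ‖fn w.1.1‖ ^ 2)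
    + (‖w.2.2‖ ^ 2 + ‖grad w.1.2‖ ^ 2 + m₂ ^ 2 * ‖fn w.1.2‖ ^ 2)) - G w.1

/-- The charge `Q(u, v) = (v₁, i u₁)_{L²} + 2 (v₂, i u₂)_{L²}`. -/
def Q {N : ℕ} (w : EnergySpace N) : ℝ :=
  l2Inner w.2.1 (Complex.I • (fn w.1.1)) + 2 * l2Inner w.2.2 (Complex.I • (fn w.1.2))

/-- `K(v) = (‖v₁‖² + ‖v₂‖²) / 2`. -/
def K {N : ℕ} (v : L2Pair N) : ℝ := 1 / 2 * (‖v.1‖ ^ 2 + ‖v.2‖ ^ 2)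

/-- `M(u) = (m₁² ‖u₁‖² + m₂² ‖u₂‖²) / 2`. -/
def M {N : ℕ} (m₁ m₂ : ℝ) (u : H1Pair N) : ℝ :=
  1 / 2 * (m₁ ^ 2 * ‖fn u.1‖ ^ 2 + m₂ ^ 2 * ‖fn u.2‖ ^ 2)

/-- `L(u) = - (‖∇u₁‖² + ‖∇u₂‖²) / 2 + G(u)`. -/
def L {N : ℕ} (u : H1Pair N) : ℝ :=
  -(1 / 2) * (‖grad u.1‖ ^ 2 + ‖grad u.2‖ ^ 2) + G u

/-- `H(u, v) = -α K(v) + α M(u) - (α + 2) L(u)`. -/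
def H {N : ℕ} (m₁ m₂ : ℝ) (w : EnergySpace N) : ℝ :=
  -alpha N * K w.2 + alpha N * M m₁ m₂ w.1 - (alpha N + 2) * L w.1

/-- `M_ω(u) = (m₁² - ω²)/2 ‖u₁‖² + (m₂² - 4ω²)/2 ‖u₂‖²`. -/
def Mom {N : ℕ} (m₁ m₂ ω : ℝ) (u : H1Pair N) : ℝ :=
  (m₁ ^ 2 - ω ^ 2) / 2 * ‖fn u.1‖ ^ 2 + (m₂ ^ 2 - 4 * ω ^ 2) / 2 * ‖fn u.2‖ ^ 2

/-- The action `J_ω = M_ω - L`. -/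
def Jom {N : ℕ} (m₁ m₂ ω : ℝ) (u : H1Pair N) : ℝ := Mom m₁ m₂ ω u - L u

/-- `P_ω(u) = α M_ω(u) - (α + 2) L(u)`. -/
def Pom {N : ℕ} (m₁ m₂ ω : ℝ) (u : H1Pair N) : ℝ :=
  alpha N * Mom m₁ m₂ ω u - (alpha N + 2) * L u

/-- The set `𝒩_ω` of nontrivial critical points of `J_ω` on `H¹(ℝ^N)²`: the real Fréchet
derivative `J_ω'(u)` vanishes. -/
def criticalSet (N : ℕ) (m₁ m₂ ω : ℝ) : Set (H1Pair N) :=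
  {u | u ≠ 0 ∧ HasFDerivAt (Jom m₁ m₂ ω) (0 : H1Pair N →L[ℝ] ℝ) u}

/-- The set `𝒢_ω` of ground states: elements of `𝒩_ω` of least action. -/
def groundStates (N : ℕ) (m₁ m₂ ω : ℝ) : Set (H1Pair N) :=
  {φ | φ ∈ criticalSet N m₁ m₂ ω ∧ ∀ u ∈ criticalSet N m₁ m₂ ω, Jom m₁ m₂ ω φ ≤ Jom m₁ m₂ ω u}

/-- `f` is radially symmetric: invariant (almost everywhere) under all linear isometries. -/
def IsRadial {N : ℕ} (f : L2 N) : Prop :=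
  ∀ R : Space N ≃ₗᵢ[ℝ] Space N, (fun x => f (R x)) =ᵐ[volume] f

/-- `ψ_ω = (i ω φ₁, 2 i ω φ₂)`. -/
def velocity {N : ℕ} (ω : ℝ) (φ : H1Pair N) : L2Pair N :=
  ((Complex.I * ω) • (fn φ.1), (2 * Complex.I * ω) • (fn φ.2))

end KleinGordon

end

open KleinGordon

noncomputable section

namespace KleinGordon

open Filter Topology Metric
open scoped ENNReal Convolution

variable {N : ℕ}

/-! Let `quad` be the quadratic part of J_ω, so J_ω = `quad` - G. The key fact about the ground
state φ is that it minimizes the scale-invariant quotient `quad`³/G² (`groundState_minimizes`).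
Indeed G attains its supremum on {`quad` = 1} (`exists_maximizer`), and the multiple of a maximizer
with 2 `quad` = 3 G is a critical point of J_ω (`quadVar_eq_GVar`, `hasFDerivAt_Jom_zero`). Every
critical point satisfies this normalization, so its action is `quad`/3 and its quotient is 9
`quad`/4: least action means least quotient.

Attainment is concentration-compactness through averages over small balls. By the translation
estimate a function in H¹ is close in L² to its averages; this yields the L³ Sobolev bound,
nonvanishing of maximizing sequences and local compactness. After recentring, a weak limit is
nonzero, G and `quad` split asymptotically, and a^(3/2) + (1-a)^(3/2) < 1 for 0 < a < 1 excludes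
loss of mass.

Put q = M_ω(φ), m = M_ω(u), l = L(u). Comparing φ with the dilates of a function
(`groundState_dilation`) gives, for φ itself, the Pohozaev identity, and for the competitor u, 2lq ≤
m² if N = 2 and 3lq² ≤ m³ if N = 3. Since P_ω(u) < 0, one has m = 2lx or m = 3lx² with 0 < x < 1,
hence q ≤ 2lx² or q ≤ 3lx³. The claim becomes 2K(ψ) + q/2 ≤ 2K(v) + l, respectively 2K(ψ) + 2q/3 ≤
2K(v) + 2l. It is immediate if K(ψ) ≤ K(v). Otherwise the assumption on φ bounds K(v) ≤ K(ψ) in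
terms of q, and equality of the charges, used through Young's inequality with weight x, together
with H ≤ 0 concludes (`final_bound_two`, `final_bound_three`). -/

/-! ### Weak gradients and the translation estimate in L². -/

theorem H1.isWeakGradient (u : H1 N) : IsWeakGradient (fn u) (grad u) := u.2

theorem norm_integral_mul_le {X : Type*} [MeasurableSpace X] {μ : Measure X} {a b : X → ℂ}
    (ha : MemLp a 2 μ) (hb : MemLp b 2 μ) :
    ‖∫ x, a x * b x ∂μ‖ ≤ (eLpNorm a 2 μ).toReal * (eLpNorm b 2 μ).toReal := by
  have hs : MemLp (fun x => conj (a x)) 2 μ := ha.star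
  have h := norm_inner_le_norm (𝕜 := ℂ) (hs.toLp _) (hb.toLp _)
  have hn : eLpNorm (fun x => conj (a x)) 2 μ = eLpNorm a 2 μ :=
    eLpNorm_congr_norm_ae (Eventually.of_forall fun x => by simp)
  rw [L2.inner_def, Lp.norm_toLp, Lp.norm_toLp, hn] at h
  refine le_trans (le_of_eq ?_) h
  congr 1
  apply integral_congr_ae
  filter_upwards [hs.coeFn_toLp, hb.coeFn_toLp] with x h1 h2
  rw [h1, h2]
  simp [mul_comm]

/-- The linear form `w ↦ ∑ⱼ hⱼ wⱼ` on `ℂ^N` attached to a real vector `h`. -/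
def dirForm (h : Space N) : EuclideanSpace ℂ (Fin N) →L[ℂ] ℂ :=
  innerSL ℂ (WithLp.toLp 2 fun j => (h j : ℂ))

theorem dirForm_apply (h : Space N) (w : EuclideanSpace ℂ (Fin N)) :
    dirForm h w = ∑ j, (h j : ℂ) * w j := by
  simp [dirForm, PiLp.inner_apply, mul_comm]

theorem norm_dirForm_apply_le (h : Space N) (w : EuclideanSpace ℂ (Fin N)) :
    ‖dirForm h w‖ ≤ ‖h‖ * ‖w‖ := by
  have e := norm_inner_le_norm (𝕜 := ℂ) (WithLp.toLp 2 fun j => (h j : ℂ)) w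
  refine e.trans (le_of_eq ?_)
  congr 1
  simp [EuclideanSpace.norm_eq]

theorem integrable_mul_of_memLp {η : Space N → ℂ} (hη : Continuous η)
    (hc : HasCompactSupport η) {f : Space N → ℂ} (hf : MemLp f 2 volume) :
    Integrable (fun x => η x * f x) volume :=
  memLp_one_iff_integrable.1 (hf.smul (hη.memLp_of_hasCompactSupport hc (p := 2)))

theorem IsWeakGradient.integral_fderiv_real {f : Space N → ℂ}
    {g : Space N → EuclideanSpace ℂ (Fin N)} (H : IsWeakGradient f g) (hf : MemLp f 2 volume)
    (hg : MemLp g 2 volume) {η : Space N → ℝ} (hη : ContDiff ℝ (⊤ : ℕ∞) η)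
    (hc : HasCompactSupport η) (h : Space N) :
    ∫ x, (fderiv ℝ η x h) • f x = - ∫ x, η x • dirForm h (g x) := by
  have hgj (j : Fin N) : MemLp (fun x => g x j) 2 volume :=
    (EuclideanSpace.proj j : EuclideanSpace ℂ (Fin N) →L[ℂ] ℂ).comp_memLp' hg
  have e : h = ∑ j, h j • EuclideanSpace.single j (1 : ℝ) := by
    ext i; simp [Finset.sum_apply, Pi.single_apply]
  have h1 : ∀ x, (fderiv ℝ η x h) • f x
      = ∑ j, (h j) • ((fderiv ℝ η x (EuclideanSpace.single j 1)) • f x) := by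
    intro x
    conv_lhs => rw [e]
    simp only [map_sum, map_smul, Finset.sum_smul, smul_eq_mul, mul_smul]
  have h2 : ∀ x, η x • dirForm h (g x) = ∑ j, (h j) • (η x • g x j) := by
    intro x
    rw [dirForm_apply, Finset.smul_sum]
    refine Finset.sum_congr rfl fun j _ => ?_
    simp only [Complex.real_smul]
    ring
  simp only [h1, h2]
  rw [integral_finsetSum, integral_finsetSum, ← Finset.sum_neg_distrib]
  · refine Finset.sum_congr rfl fun j _ => ?_
    rw [integral_smul, integral_smul, H η hη hc j, smul_neg]
  · exact fun j _ => (integrable_smul_of_L2 hη.continuous hc (hgj j)).smul (h j)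
  · exact fun j _ => (integrable_fderiv_smul_of_L2 hη hc j hf).smul (h j)

/-- Complex test functions are needed because the L² norm is later recovered by duality with smooth
complex functions. The real and imaginary parts of η are tested separately. -/
theorem IsWeakGradient.integral_fderiv_complex {f : Space N → ℂ}
    {g : Space N → EuclideanSpace ℂ (Fin N)} (H : IsWeakGradient f g) (hf : MemLp f 2 volume)
    (hg : MemLp g 2 volume) {η : Space N → ℂ} (hη : ContDiff ℝ (⊤ : ℕ∞) η)
    (hc : HasCompactSupport η) (h : Space N) :
    ∫ x, (fderiv ℝ η x h) * f x = - ∫ x, η x * dirForm h (g x) := by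
  have hre : ContDiff ℝ (⊤ : ℕ∞) (fun x => (η x).re) := Complex.reCLM.contDiff.comp hη
  have him : ContDiff ℝ (⊤ : ℕ∞) (fun x => (η x).im) := Complex.imCLM.contDiff.comp hη
  have cre : HasCompactSupport (fun x => (η x).re) := hc.comp_left (g := Complex.re) rfl
  have cim : HasCompactSupport (fun x => (η x).im) := hc.comp_left (g := Complex.im) rfl
  have hd : ∀ x, DifferentiableAt ℝ η x := fun x => (hη.differentiable (by simp)) x
  have dre : ∀ x, fderiv ℝ (fun x => (η x).re) x h = (fderiv ℝ η x h).re := fun x => by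
    have e : HasFDerivAt (fun x => (η x).re) (Complex.reCLM.comp (fderiv ℝ η x)) x :=
      Complex.reCLM.hasFDerivAt.comp x (hd x).hasFDerivAt
    rw [e.fderiv]; rfl
  have dim : ∀ x, fderiv ℝ (fun x => (η x).im) x h = (fderiv ℝ η x h).im := fun x => by
    have e : HasFDerivAt (fun x => (η x).im) (Complex.imCLM.comp (fderiv ℝ η x)) x :=
      Complex.imCLM.hasFDerivAt.comp x (hd x).hasFDerivAt
    rw [e.fderiv]; rfl
  have key (z w : ℂ) : z * w = z.re • w + Complex.I * (z.im • w) := by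
    conv_lhs => rw [← Complex.re_add_im z]
    simp only [Complex.real_smul]; ring
  have hg' : MemLp (fun x => dirForm h (g x)) 2 volume := (dirForm h).comp_memLp' hg
  have i1 : Integrable (fun x => (fderiv ℝ η x h).re • f x) volume := by
    simp only [← dre]
    exact integrable_smul_of_L2 ((hre.continuous_fderiv (by simp)).clm_apply continuous_const)
      (cre.fderiv_apply ℝ _) hf
  have i2 : Integrable (fun x => (fderiv ℝ η x h).im • f x) volume := by
    simp only [← dim]
    exact integrable_smul_of_L2 ((him.continuous_fderiv (by simp)).clm_apply continuous_const)
      (cim.fderiv_apply ℝ _) hf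
  calc ∫ x, (fderiv ℝ η x h) * f x
      = ∫ x, ((fderiv ℝ η x h).re • f x + Complex.I * ((fderiv ℝ η x h).im • f x)) := by
        simp only [← key]
    _ = (∫ x, (fderiv ℝ η x h).re • f x) + Complex.I * ∫ x, (fderiv ℝ η x h).im • f x := by
        rw [integral_add i1 (i2.const_mul _), integral_const_mul]
    _ = -((∫ x, (η x).re • dirForm h (g x))
          + Complex.I * ∫ x, (η x).im • dirForm h (g x)) := by
        have e1 := H.integral_fderiv_real hf hg hre cre h
        have e2 := H.integral_fderiv_real hf hg him cim h
        simp only [dre, dim] at e1 e2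
        rw [e1, e2]; ring
    _ = - ∫ x, η x * dirForm h (g x) := by
        rw [← integral_const_mul, ← integral_add
          (integrable_smul_of_L2 hre.continuous cre hg')
          ((integrable_smul_of_L2 him.continuous cim hg').const_mul _)]
        simp only [← key]

/-- The derivative of t ↦ ∫ η(x - t h) f is, by the weak gradient, the pairing of a translate of η
with the derivative of f along h, which Cauchy–Schwarz bounds independently of t. The mean value
inequality on [0, 1] concludes. -/
theorem IsWeakGradient.norm_integral_translate_sub_le {f : Space N → ℂ}
    {g : Space N → EuclideanSpace ℂ (Fin N)} (H : IsWeakGradient f g) (hf : MemLp f 2 volume)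
    (hg : MemLp g 2 volume) {η : Space N → ℂ} (hη : ContDiff ℝ (⊤ : ℕ∞) η)
    (hc : HasCompactSupport η) (h : Space N) :
    ‖(∫ x, η (x - h) * f x) - ∫ x, η x * f x‖
      ≤ (eLpNorm η 2 volume).toReal * (‖h‖ * (eLpNorm g 2 volume).toReal) := by
  -- Reflecting η turns the pairing into a convolution, for which differentiation under the integral
  -- is available.
  set θ : Space N → ℂ := fun z => η (-z) with hθ
  have θs : ContDiff ℝ (⊤ : ℕ∞) θ := hη.comp contDiff_neg
  have θc : HasCompactSupport θ := hc.comp_homeomorph (Homeomorph.neg _)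
  have lf : LocallyIntegrable f volume := hf.locallyIntegrable (by norm_num)
  let Lm := ContinuousLinearMap.mul ℝ ℂ
  let F : ℝ → ℂ := fun t => (f ⋆[Lm, volume] θ) (t • h)
  let F' : ℝ → ℂ := fun t => ((f ⋆[Lm.precompR (Space N), volume] fderiv ℝ θ) (t • h)) h
  have hF : ∀ t, F t = ∫ x, η (x - t • h) * f x := fun t => by
    simp only [F, convolution_def, Lm, ContinuousLinearMap.mul_apply', hθ, neg_sub, mul_comm]
  have hF' : ∀ t, F' t = ∫ x, η (x - t • h) * dirForm h (g x) := fun t => by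
    have s' : ContDiff ℝ (⊤ : ℕ∞) (fun x => η (x - t • h)) :=
      hη.comp (contDiff_id.sub contDiff_const)
    have c' : HasCompactSupport (fun x => η (x - t • h)) :=
      hc.comp_homeomorph (Homeomorph.subRight (t • h))
    have e := H.integral_fderiv_complex hf hg s' c' h
    rw [← neg_eq_iff_eq_neg] at e
    rw [← e]
    simp only [F']
    rw [convolution_precompR_apply Lm lf (θc.fderiv ℝ) (θs.continuous_fderiv (by simp)),
      convolution_def, ← integral_neg]
    congr 1
    ext x
    have d1 : fderiv ℝ θ (t • h - x) = - fderiv ℝ η (x - t • h) := by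
      have e : HasFDerivAt θ ((fderiv ℝ η (-(t • h - x))).comp (-ContinuousLinearMap.id ℝ _))
          (t • h - x) :=
        ((hη.differentiable (by simp) _).hasFDerivAt).comp (t • h - x)
          (hasFDerivAt_id (𝕜 := ℝ) (t • h - x)).neg
      rw [e.fderiv, neg_sub]
      ext; simp
    have d2 : fderiv ℝ (fun x => η (x - t • h)) x = fderiv ℝ η (x - t • h) :=
      fderiv_comp_sub _
    rw [d1, d2]
    simp [Lm, mul_comm]
  have hd : ∀ t, HasDerivAt F (F' t) t := fun t => by
    have h1 := θc.hasFDerivAt_convolution_right Lm lf (θs.of_le (by exact_mod_cast le_top)) (t • h)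
    have h2 : HasDerivAt (fun s : ℝ => s • h) h t := by
      simpa using (hasDerivAt_id t).smul_const h
    exact h1.comp_hasDerivAt t h2
  have hb : ∀ t, ‖F' t‖ ≤ (eLpNorm η 2 volume).toReal * (‖h‖ * (eLpNorm g 2 volume).toReal) := by
    intro t
    rw [hF']
    have mη : MemLp η 2 volume := hη.continuous.memLp_of_hasCompactSupport hc
    have mp := measurePreserving_sub_right (volume : Measure (Space N)) (t • h)
    have m1 : MemLp (fun x => η (x - t • h)) 2 volume := mη.comp_measurePreserving mp
    have n1 : eLpNorm (fun x => η (x - t • h)) 2 volume = eLpNorm η 2 volume :=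
      eLpNorm_comp_measurePreserving mη.1 mp
    refine (norm_integral_mul_le m1 ((dirForm h).comp_memLp' hg)).trans ?_
    rw [n1]
    gcongr
    have : eLpNorm (fun x => dirForm h (g x)) 2 volume
        ≤ ENNReal.ofReal ‖h‖ * eLpNorm g 2 volume :=
      eLpNorm_le_mul_eLpNorm_of_ae_le_mul
        (Eventually.of_forall fun x => norm_dirForm_apply_le h (g x)) 2
    have := ENNReal.toReal_mono (ENNReal.mul_ne_top ENNReal.ofReal_ne_top hg.2.ne) this
    rwa [ENNReal.toReal_mul, ENNReal.toReal_ofReal (norm_nonneg _)] at this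
  have := norm_image_sub_le_of_norm_deriv_le_segment_01' (f := F) (f' := F')
    (fun t _ => (hd t).hasDerivWithinAt) (fun t _ => hb t)
  rw [hF, hF] at this
  simpa using this

/-- The translation estimate `‖f(· + h) - f‖_{L²} ≤ |h| ‖∇f‖_{L²}`. -/
theorem eLpNorm_translate_sub_le (u : H1 N) (h : Space N) :
    eLpNorm (fun x => fn u (x + h) - fn u x) 2 volume ≤ ENNReal.ofReal (‖h‖ * ‖grad u‖) := by
  have mp := measurePreserving_add_right (volume : Measure (Space N)) h
  have mu := Lp.memLp (fn u)
  have mt : MemLp (fun x => fn u (x + h)) 2 volume := mu.comp_measurePreserving mp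
  have mF : MemLp (fun x => fn u (x + h) - fn u x) 2 volume := mt.sub mu
  set F : L2 N := mF.toLp _ with hF
  suffices hs : ‖F‖ ≤ ‖h‖ * ‖grad u‖ by
    rw [hF, Lp.norm_toLp] at hs
    exact (ENNReal.le_ofReal_iff_toReal_le mF.2.ne (by positivity)).2 hs
  -- Duality: the bound is closed in z, so it suffices to prove it for smooth compactly supported z;
  -- taking z = F then recovers the norm.
  have hall : ∀ z : L2 N, ‖(inner ℂ z F : ℂ)‖ ≤ ‖z‖ * (‖h‖ * ‖grad u‖) := by
    intro z
    have hcl : IsClosed {z : L2 N | ‖(inner ℂ z F : ℂ)‖ ≤ ‖z‖ * (‖h‖ * ‖grad u‖)} :=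
      isClosed_le (by fun_prop) (by fun_prop)
    have hsub : {f : L2 N | ∃ g : Space N → ℂ, f =ᵐ[volume] g ∧ HasCompactSupport g ∧
        ContDiff ℝ (⊤ : ℕ∞) g} ⊆ {z : L2 N | ‖(inner ℂ z F : ℂ)‖ ≤ ‖z‖ * (‖h‖ * ‖grad u‖)} := by
      rintro z ⟨ζ, hz, hc, hs⟩
      set η : Space N → ℂ := fun x => conj (ζ x)
      have ηs : ContDiff ℝ (⊤ : ℕ∞) η := Complex.conjCLE.contDiff.comp hs
      have ηc : HasCompactSupport η := hc.comp_left (g := conj) (by simp)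
      have e1 : (inner ℂ z F : ℂ) = (∫ x, η (x - h) * fn u x) - ∫ x, η x * fn u x := by
        have : ∫ x, η (x - h) * fn u x = ∫ x, η x * fn u (x + h) := by
          rw [← integral_add_right_eq_self (fun x => η (x - h) * fn u x) h]
          simp
        rw [this, L2.inner_def, ← integral_sub (integrable_mul_of_memLp ηs.continuous ηc mt)
          (integrable_mul_of_memLp ηs.continuous ηc mu)]
        apply integral_congr_ae
        filter_upwards [hz, mF.coeFn_toLp] with x h1 h2
        rw [h1, h2]
        simp [η]; ring
      have e2 : (eLpNorm η 2 volume).toReal = ‖z‖ := by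
        rw [Lp.norm_def, eLpNorm_congr_ae hz]
        congr 1
        exact eLpNorm_congr_norm_ae (Eventually.of_forall fun x => by simp [η])
      have := (H1.isWeakGradient u).norm_integral_translate_sub_le mu (Lp.memLp (grad u)) ηs ηc h
      rw [Set.mem_ofPred_eq, e1, ← e2]
      exact this
    exact (closure_minimal hsub hcl) (Lp.dense_hasCompactSupport_contDiff (by simp) z)
  rcases eq_or_ne F 0 with h0 | h0
  · rw [h0, norm_zero]; positivity
  · have := hall F
    rw [inner_self_eq_norm_sq_to_K] at this
    simp only [sq, norm_mul, Complex.norm_real, Complex.coe_algebraMap, norm_norm] at this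
    exact le_of_mul_le_mul_left this (norm_pos_iff.2 h0)

/-! ### Averages over balls. -/

theorem eLpNorm_two_sq {X F : Type*} [MeasurableSpace X] [NormedAddCommGroup F] {μ : Measure X}
    (f : X → F) : eLpNorm f 2 μ ^ 2 = ∫⁻ x, ‖f x‖ₑ ^ 2 ∂μ := by
  rw [eLpNorm_eq_lintegral_rpow_enorm_toReal (by simp) (by simp)]
  simp only [ENNReal.toReal_ofNat, ENNReal.rpow_ofNat]
  rw [← ENNReal.rpow_natCast, ← ENNReal.rpow_mul]
  norm_num

theorem lintegral_enorm_sq_eq {X F : Type*} [MeasurableSpace X] [NormedAddCommGroup F]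
    {μ : Measure X} (f : Lp F 2 μ) : ∫⁻ x, ‖f x‖ₑ ^ 2 ∂μ = ENNReal.ofReal (‖f‖ ^ 2) := by
  rw [← eLpNorm_two_sq, Lp.norm_def, ENNReal.ofReal_pow ENNReal.toReal_nonneg,
    ENNReal.ofReal_toReal (Lp.memLp f).2.ne]

theorem enorm_integral_sq_le {X F : Type*} [MeasurableSpace X] [NormedAddCommGroup F]
    [NormedSpace ℝ F] {μ : Measure X} [IsProbabilityMeasure μ] {f : X → F}
    (hf : AEStronglyMeasurable f μ) : ‖∫ x, f x ∂μ‖ₑ ^ 2 ≤ ∫⁻ x, ‖f x‖ₑ ^ 2 ∂μ := by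
  rw [← eLpNorm_two_sq]
  gcongr
  calc ‖∫ x, f x ∂μ‖ₑ ≤ ∫⁻ x, ‖f x‖ₑ ∂μ := enorm_integral_le_lintegral_enorm f
    _ = eLpNorm f 1 μ := eLpNorm_one_eq_lintegral_enorm.symm
    _ ≤ eLpNorm f 2 μ := eLpNorm_le_eLpNorm_of_exponent_le (by norm_num) hf

/-- The uniform probability measure on the ball of radius `ε` about the origin. -/
def ballMeasure (N : ℕ) (ε : ℝ) : Measure (Space N) := ProbabilityTheory.cond volume (ball 0 ε)

theorem ballMeasure_def (N : ℕ) (ε : ℝ) : ballMeasure N ε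
    = (volume (ball (0 : Space N) ε))⁻¹ • volume.restrict (ball 0 ε) := rfl

theorem isProbabilityMeasure_ballMeasure (N : ℕ) {ε : ℝ} (hε : 0 < ε) :
    IsProbabilityMeasure (ballMeasure N ε) :=
  ProbabilityTheory.cond_isProbabilityMeasure_of_finite (measure_ball_pos _ _ hε).ne'
    measure_ball_lt_top.ne

theorem ballMeasure_absolutelyContinuous (N : ℕ) (ε : ℝ) :
    ballMeasure N ε ≪ (volume : Measure (Space N)) :=
  ProbabilityTheory.cond_absolutelyContinuous

theorem lintegral_ballMeasure_le (N : ℕ) (ε : ℝ) (F : Space N → ℝ≥0∞) :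
    ∫⁻ h, F h ∂(ballMeasure N ε) ≤ (volume (ball (0 : Space N) ε))⁻¹ * ∫⁻ h, F h := by
  rw [ballMeasure_def, lintegral_smul_measure, smul_eq_mul]
  gcongr
  exact Measure.restrict_le_self

/-- The average of `f` over the ball of radius `ε` about `x`. -/
def ballAvg (ε : ℝ) (f : Space N → ℂ) (x : Space N) : ℂ := ∫ h, f (x + h) ∂(ballMeasure N ε)

theorem aestronglyMeasurable_translate (f : L2 N) (x : Space N) (μ : Measure (Space N)) :
    AEStronglyMeasurable (fun h => f (x + h)) μ :=
  ((Lp.stronglyMeasurable f).comp_measurable (measurable_const_add x)).aestronglyMeasurable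

theorem enorm_ballAvg_sq_le (f : L2 N) {ε : ℝ} (hε : 0 < ε) (x : Space N) :
    ‖ballAvg ε f x‖ₑ ^ 2 ≤ (volume (ball (0 : Space N) ε))⁻¹ * ENNReal.ofReal (‖f‖ ^ 2) := by
  have := isProbabilityMeasure_ballMeasure N hε
  refine (enorm_integral_sq_le (aestronglyMeasurable_translate f x _)).trans ?_
  refine (lintegral_ballMeasure_le N ε _).trans ?_
  rw [lintegral_add_left_eq_self (fun h => ‖f h‖ₑ ^ 2) x, lintegral_enorm_sq_eq]

theorem integrable_translate_ballMeasure (f : L2 N) {ε : ℝ} (hε : 0 < ε) (x : Space N) :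
    Integrable (fun h => f (x + h)) (ballMeasure N ε) := by
  have := isProbabilityMeasure_ballMeasure N hε
  have m : MemLp (fun h => f (x + h)) 2 (ballMeasure N ε) := by
    refine ⟨aestronglyMeasurable_translate f x _, ?_⟩
    have h2 : eLpNorm (fun h => f (x + h)) 2 (ballMeasure N ε) ^ 2 < ∞ := by
      rw [eLpNorm_two_sq]
      refine (lintegral_ballMeasure_le N ε _).trans_lt ?_
      rw [lintegral_add_left_eq_self (fun h => ‖f h‖ₑ ^ 2) x, lintegral_enorm_sq_eq]
      exact ENNReal.mul_lt_top (ENNReal.inv_lt_top.2 (measure_ball_pos _ _ hε))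
        ENNReal.ofReal_lt_top
    by_contra hc
    rw [not_lt, top_le_iff] at hc
    rw [hc] at h2
    simp at h2
  exact m.integrable (by norm_num)

theorem stronglyMeasurable_ballAvg (f : L2 N) {ε : ℝ} (hε : 0 < ε) :
    StronglyMeasurable (ballAvg ε f) := by
  have := isProbabilityMeasure_ballMeasure N hε
  have : StronglyMeasurable (fun p : Space N × Space N => f (p.1 + p.2)) :=
    (Lp.stronglyMeasurable f).comp_measurable (measurable_fst.add measurable_snd)
  exact this.integral_prod_right

/-- `‖f - S_ε f‖_{L²} ≤ ε ‖∇f‖_{L²}` for the averages `S_ε f` over balls. -/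
theorem lintegral_sub_ballAvg_sq_le (u : H1 N) {ε : ℝ} (hε : 0 < ε) :
    ∫⁻ x, ‖fn u x - ballAvg ε (fn u) x‖ₑ ^ 2 ≤ ENNReal.ofReal ((ε * ‖grad u‖) ^ 2) := by
  have := isProbabilityMeasure_ballMeasure N hε
  set f := fn u
  have hm : StronglyMeasurable (fun p : Space N × Space N => f p.1 - f (p.1 + p.2)) :=
    ((Lp.stronglyMeasurable f).comp_measurable measurable_fst).sub
      ((Lp.stronglyMeasurable f).comp_measurable (measurable_fst.add measurable_snd))
  -- Jensen inside, then Tonelli: the error is an average over |h| < ε of translation differences.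
  have h1 : ∀ x, ‖f x - ballAvg ε f x‖ₑ ^ 2
      ≤ ∫⁻ h, ‖f x - f (x + h)‖ₑ ^ 2 ∂(ballMeasure N ε) := by
    intro x
    have : f x - ballAvg ε f x = ∫ h, (f x - f (x + h)) ∂(ballMeasure N ε) := by
      rw [integral_sub (integrable_const _) (integrable_translate_ballMeasure f hε x)]
      simp [ballAvg]
    rw [this]
    exact enorm_integral_sq_le
      (aestronglyMeasurable_const.sub (aestronglyMeasurable_translate f x _))
  calc ∫⁻ x, ‖f x - ballAvg ε f x‖ₑ ^ 2
      ≤ ∫⁻ x, ∫⁻ h, ‖f x - f (x + h)‖ₑ ^ 2 ∂(ballMeasure N ε) := lintegral_mono h1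
    _ = ∫⁻ h, (∫⁻ x, ‖f x - f (x + h)‖ₑ ^ 2) ∂(ballMeasure N ε) :=
        lintegral_lintegral_swap (μ := volume) (ν := ballMeasure N ε)
          (f := fun x h => ‖f x - f (x + h)‖ₑ ^ 2) (hm.enorm.pow_const 2).aemeasurable
    _ ≤ ∫⁻ _, ENNReal.ofReal ((ε * ‖grad u‖) ^ 2) ∂(ballMeasure N ε) := by
        refine lintegral_mono_ae (μ := ballMeasure N ε) ?_
        have hb : ∀ᵐ h ∂(ballMeasure N ε), h ∈ ball (0 : Space N) ε :=
          ProbabilityTheory.ae_cond_mem measurableSet_ball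
        filter_upwards [hb] with h hh
        have hh' : ‖h‖ ≤ ε := by simpa using (mem_ball_zero_iff.1 hh).le
        have e := eLpNorm_translate_sub_le u h
        have e2 : ∫⁻ x, ‖f x - f (x + h)‖ₑ ^ 2 = eLpNorm (fun x => f (x + h) - f x) 2 volume ^ 2 := by
          rw [eLpNorm_two_sq]
          congr 1; ext x; rw [← enorm_neg, neg_sub]
        rw [e2, ENNReal.ofReal_pow (by positivity)]
        gcongr
        exact e.trans (ENNReal.ofReal_le_ofReal (by gcongr))
    _ = ENNReal.ofReal ((ε * ‖grad u‖) ^ 2) := by simp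

/-! ### Distribution functions and cubic integrability. -/

theorem volume_ball_eq (N : ℕ) {ε : ℝ} (hε : 0 < ε) : volume (ball (0 : Space N) ε)
    = ENNReal.ofReal (ε ^ N) * volume (ball (0 : Space N) 1) := by
  have := Measure.addHaar_ball_of_pos (volume : Measure (Space N)) 0 hε
  simpa using this

/-- Where |f| > t the average is at most t/2, so f differs from its average by at least t/2;
Chebyshev applies, that difference having L² norm at most ε. -/
theorem volume_lt_norm_le (u : H1 N) (hg : ‖grad u‖ ≤ 1) {ε t : ℝ} (hε : 0 < ε) (ht : 0 < t)
    (ha : ∀ x, ‖ballAvg ε (fn u) x‖ ≤ t / 2) :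
    volume {x | t < ‖fn u x‖} ≤ ENNReal.ofReal (4 * ε ^ 2 / t ^ 2) := by
  have hm : AEMeasurable (fun x => ‖fn u x - ballAvg ε (fn u) x‖ₑ ^ 2) volume :=
    (((Lp.stronglyMeasurable (fn u)).sub
      (stronglyMeasurable_ballAvg (fn u) hε)).enorm.pow_const 2).aemeasurable
  have ht2 : 0 < (t / 2) ^ 2 := by positivity
  have h1 : {x | t < ‖fn u x‖}
      ⊆ {x | ENNReal.ofReal ((t / 2) ^ 2) ≤ ‖fn u x - ballAvg ε (fn u) x‖ₑ ^ 2} := by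
    intro x hx
    have hx : t < ‖fn u x‖ := hx
    have : t / 2 ≤ ‖fn u x - ballAvg ε (fn u) x‖ := by
      have := norm_sub_norm_le (fn u x) (ballAvg ε (fn u) x)
      linarith [ha x]
    rw [Set.mem_ofPred_eq, ENNReal.ofReal_pow (by positivity), ← ofReal_norm]
    gcongr
  calc volume {x | t < ‖fn u x‖} ≤ _ := measure_mono h1
    _ ≤ (∫⁻ x, ‖fn u x - ballAvg ε (fn u) x‖ₑ ^ 2) / ENNReal.ofReal ((t / 2) ^ 2) :=
        meas_ge_le_lintegral_div hm (ENNReal.ofReal_pos.2 ht2).ne' ENNReal.ofReal_ne_top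
    _ ≤ ENNReal.ofReal (ε ^ 2) / ENNReal.ofReal ((t / 2) ^ 2) := by
        gcongr
        refine (lintegral_sub_ballAvg_sq_le u hε).trans (ENNReal.ofReal_le_ofReal ?_)
        have : ε * ‖grad u‖ ≤ ε * 1 := by gcongr
        rw [mul_one] at this
        gcongr
    _ = ENNReal.ofReal (4 * ε ^ 2 / t ^ 2) := by
        rw [← ENNReal.ofReal_div_of_pos ht2]
        congr 1
        field_simp
        norm_num

theorem norm_ballAvg_sq_le (f : L2 N) {ε : ℝ} (hε : 0 < ε) (x : Space N) :
    ‖ballAvg ε f x‖ ^ 2 ≤ ‖f‖ ^ 2 / (ε ^ N * volume.real (ball (0 : Space N) 1)) := by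
  have h := enorm_ballAvg_sq_le f hε x
  have hV : 0 < volume.real (ball (0 : Space N) 1) :=
    ENNReal.toReal_pos (measure_ball_pos _ _ one_pos).ne' measure_ball_lt_top.ne
  have h2 := ENNReal.toReal_mono (ENNReal.mul_ne_top
    (ENNReal.inv_ne_top.2 (measure_ball_pos _ _ hε).ne') ENNReal.ofReal_ne_top) h
  rw [volume_ball_eq N hε] at h2
  simp only [ENNReal.toReal_pow, toReal_enorm, ENNReal.toReal_mul, ENNReal.toReal_inv,
    ENNReal.toReal_ofReal (sq_nonneg ‖f‖),
    ENNReal.toReal_ofReal (pow_pos hε N).le] at h2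
  refine h2.trans (le_of_eq ?_)
  rw [Measure.real]
  field_simp

/-- The radius is tuned to the height: with V the volume of the unit ball, ε^N = 4/(V t²) makes
every average at most t/2. Then ε² is a multiple of t^(-4/N), which is at most t^(-4/3) for t ≥ 1.
This extra decay makes t² times the distribution function integrable at infinity. -/
theorem exists_volume_lt_norm_le (hN : N = 2 ∨ N = 3) : ∃ C : ℝ, 0 < C ∧ ∀ u : H1 N,
    ‖fn u‖ ≤ 1 → ‖grad u‖ ≤ 1 → ∀ t : ℝ, 1 ≤ t →
      volume {x | t < ‖fn u x‖} ≤ ENNReal.ofReal (C * t ^ (-(4 / 3) : ℝ) / t ^ 2) := by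
  have hV : 0 < volume.real (ball (0 : Space N) 1) :=
    ENNReal.toReal_pos (measure_ball_pos _ _ one_pos).ne' measure_ball_lt_top.ne
  set V := volume.real (ball (0 : Space N) 1)
  have hN0 : (N : ℝ) ≠ 0 := by rcases hN with rfl | rfl <;> norm_num
  set c : ℝ := (4 / V) ^ (1 / (N : ℝ)) with hc
  have hc0 : 0 < c := by positivity
  refine ⟨4 * c ^ 2, by positivity, fun u hf hg t ht => ?_⟩
  have ht0 : 0 < t := by linarith
  set ε : ℝ := c * t ^ (-(2 / (N : ℝ))) with hε
  have hε0 : 0 < ε := by positivity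
  have e1 : ε ^ N = 4 / V * t ^ (-2 : ℝ) := by
    rw [hε, mul_pow, hc, ← Real.rpow_natCast, ← Real.rpow_mul (by positivity),
      ← Real.rpow_natCast, ← Real.rpow_mul (by positivity)]
    congr 1
    · rw [one_div, inv_mul_cancel₀ hN0, Real.rpow_one]
    · congr 1; field_simp
  have e2 : ε ^ 2 ≤ c ^ 2 * t ^ (-(4 / 3) : ℝ) := by
    rw [hε, mul_pow, ← Real.rpow_natCast (t ^ _), ← Real.rpow_mul (by positivity)]
    gcongr
    rcases hN with rfl | rfl <;> norm_num
  refine (volume_lt_norm_le u hg hε0 ht0 fun x => ?_).trans (ENNReal.ofReal_le_ofReal ?_)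
  · have h := norm_ballAvg_sq_le (fn u) hε0 x
    have h' : ‖ballAvg ε (fn u) x‖ ^ 2 ≤ (t / 2) ^ 2 := by
      refine h.trans ?_
      calc ‖fn u‖ ^ 2 / (ε ^ N * V) ≤ 1 ^ 2 / (ε ^ N * V) := by gcongr
        _ = (t / 2) ^ 2 := by
          rw [e1, Real.rpow_neg ht0.le, Real.rpow_two]; field_simp
          norm_num
    exact le_of_sq_le_sq h' (by positivity)
  · have : 4 * ε ^ 2 ≤ 4 * c ^ 2 * t ^ (-(4 / 3) : ℝ) := by nlinarith
    gcongr

/-- If the averages of `f` over balls of radius `ε` are small, then so is the `L³` norm of `f`. -/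
theorem exists_lintegral_cube_le (hN : N = 2 ∨ N = 3) : ∃ C : ℝ, 0 < C ∧ ∀ u : H1 N,
    ‖fn u‖ ≤ 1 → ‖grad u‖ ≤ 1 → ∀ ε δ Λ : ℝ, 0 < ε → 0 < δ → 1 ≤ Λ →
      (∀ x, ‖ballAvg ε (fn u) x‖ ≤ δ) →
      ∫⁻ x, ‖fn u x‖ₑ ^ 3
        ≤ ENNReal.ofReal (C * (δ + ε ^ 2 * Λ + Λ ^ (-(1 / 3) : ℝ))) := by
  obtain ⟨C₁, hC₁, hW⟩ := exists_volume_lt_norm_le hN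
  refine ⟨12 + 9 * C₁, by positivity, fun u hf hg ε δ Λ hε hδ hΛ ha => ?_⟩
  have hm : AEMeasurable (fun x => ‖fn u x‖) volume :=
    (Lp.stronglyMeasurable (fn u)).norm.aemeasurable
  have h0 : 0 ≤ᵐ[volume] fun x => ‖fn u x‖ := Eventually.of_forall fun x => norm_nonneg _
  have l3 := lintegral_rpow_eq_lintegral_meas_lt_mul volume h0 hm (p := 3) (by norm_num)
  have l2 := lintegral_rpow_eq_lintegral_meas_lt_mul volume h0 hm (p := 2) (by norm_num)
  have c3 : ∫⁻ x, ENNReal.ofReal (‖fn u x‖ ^ (3 : ℝ)) = ∫⁻ x, ‖fn u x‖ₑ ^ 3 := by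
    congr 1; ext x
    rw [← ofReal_norm, ← ENNReal.ofReal_pow (norm_nonneg _)]
    simp only [Real.rpow_ofNat]
  have c2 : ∫⁻ x, ENNReal.ofReal (‖fn u x‖ ^ (2 : ℝ)) = ENNReal.ofReal (‖fn u‖ ^ 2) := by
    rw [← lintegral_enorm_sq_eq]
    congr 1; ext x
    rw [← ofReal_norm, ← ENNReal.ofReal_pow (norm_nonneg _)]
    simp only [Real.rpow_ofNat]
  rw [c3] at l3
  rw [c2] at l2
  set D : ℝ → ℝ≥0∞ := fun t => volume {x | t < ‖fn u x‖} with hD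
  -- The layer-cake integral is cut at 2δ and Λ. Below 2δ, t² ≤ 2δ t and the layer-cake formula for
  -- the L² norm bounds the rest.
  have low : ∫⁻ t in Set.Ioc 0 (2 * δ), D t * ENNReal.ofReal (t ^ ((3 : ℝ) - 1))
      ≤ ENNReal.ofReal δ := by
    calc ∫⁻ t in Set.Ioc 0 (2 * δ), D t * ENNReal.ofReal (t ^ ((3 : ℝ) - 1))
        ≤ ∫⁻ t in Set.Ioc 0 (2 * δ),
            ENNReal.ofReal (2 * δ) * (D t * ENNReal.ofReal (t ^ ((2 : ℝ) - 1))) := by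
          refine setLIntegral_mono' measurableSet_Ioc fun t ht => ?_
          rw [mul_left_comm, ← ENNReal.ofReal_mul (by positivity)]
          gcongr
          have : t ^ ((3 : ℝ) - 1) = t * t ^ ((2 : ℝ) - 1) := by
            norm_num; ring
          rw [this]
          have := ht.1
          gcongr
          exact ht.2
      _ = ENNReal.ofReal (2 * δ) * ∫⁻ t in Set.Ioc 0 (2 * δ),
            D t * ENNReal.ofReal (t ^ ((2 : ℝ) - 1)) :=
          lintegral_const_mul' _ _ ENNReal.ofReal_ne_top
      _ ≤ ENNReal.ofReal (2 * δ) * ∫⁻ t in Set.Ioi 0,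
            D t * ENNReal.ofReal (t ^ ((2 : ℝ) - 1)) := by
          gcongr
          exact Set.Ioc_subset_Ioi_self
      _ = ENNReal.ofReal δ * ENNReal.ofReal (‖fn u‖ ^ 2) := by
          rw [l2, ← mul_assoc, ← ENNReal.ofReal_mul hδ.le, mul_comm δ 2]
      _ ≤ ENNReal.ofReal δ := by
          rw [← ENNReal.ofReal_mul hδ.le]
          apply ENNReal.ofReal_le_ofReal
          have : ‖fn u‖ ^ 2 ≤ 1 := pow_le_one₀ (norm_nonneg _) hf
          nlinarith
  -- For t > 2δ all averages are at most t/2, so Chebyshev at the fixed radius ε bounds the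
  -- integrand by a constant.
  have mid : ∫⁻ t in Set.Ioc (2 * δ) Λ, D t * ENNReal.ofReal (t ^ ((3 : ℝ) - 1))
      ≤ ENNReal.ofReal (4 * ε ^ 2 * Λ) := by
    calc ∫⁻ t in Set.Ioc (2 * δ) Λ, D t * ENNReal.ofReal (t ^ ((3 : ℝ) - 1))
        ≤ ∫⁻ t in Set.Ioc (2 * δ) Λ, ENNReal.ofReal (4 * ε ^ 2) := by
          refine setLIntegral_mono' measurableSet_Ioc fun t ht => ?_
          have ht0 : 0 < t := by linarith [ht.1]
          have := volume_lt_norm_le u hg hε ht0 fun x => (ha x).trans (by linarith [ht.1])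
          calc _ ≤ ENNReal.ofReal (4 * ε ^ 2 / t ^ 2) * ENNReal.ofReal (t ^ ((3 : ℝ) - 1)) := by
                gcongr
            _ = ENNReal.ofReal (4 * ε ^ 2) := by
                rw [← ENNReal.ofReal_mul (by positivity)]
                congr 1
                norm_num
                field_simp
      _ = ENNReal.ofReal (4 * ε ^ 2) * ENNReal.ofReal (Λ - 2 * δ) := by
          rw [setLIntegral_const, Real.volume_Ioc]
      _ ≤ ENNReal.ofReal (4 * ε ^ 2 * Λ) := by
          rw [ENNReal.ofReal_mul (p := 4 * ε ^ 2) (by positivity)]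
          gcongr
          linarith
  -- Above Λ the smallness of the averages plays no role: the uniform decay rate gives a convergent
  -- tail.
  have high : ∫⁻ t in Set.Ioi Λ, D t * ENNReal.ofReal (t ^ ((3 : ℝ) - 1))
      ≤ ENNReal.ofReal (3 * C₁ * Λ ^ (-(1 / 3) : ℝ)) := by
    have hΛ0 : 0 < Λ := by linarith
    calc ∫⁻ t in Set.Ioi Λ, D t * ENNReal.ofReal (t ^ ((3 : ℝ) - 1))
        ≤ ∫⁻ t in Set.Ioi Λ, ENNReal.ofReal (C₁ * t ^ (-(4 / 3) : ℝ)) := by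
          refine setLIntegral_mono' measurableSet_Ioi fun t ht => ?_
          have ht1 : 1 ≤ t := hΛ.trans (le_of_lt ht)
          have ht0 : 0 < t := by linarith
          calc _ ≤ ENNReal.ofReal (C₁ * t ^ (-(4 / 3) : ℝ) / t ^ 2)
                * ENNReal.ofReal (t ^ ((3 : ℝ) - 1)) := by
                gcongr
                exact hW u hf hg t ht1
            _ = _ := by
                rw [← ENNReal.ofReal_mul (by positivity)]
                congr 1
                rw [show ((3 : ℝ) - 1) = (2 : ℕ) by norm_num, Real.rpow_natCast]
                field_simp
      _ = ENNReal.ofReal (∫ t in Set.Ioi Λ, C₁ * t ^ (-(4 / 3) : ℝ)) := by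
          rw [ofReal_integral_eq_lintegral_ofReal]
          · exact (integrableOn_Ioi_rpow_of_lt (by norm_num) hΛ0).const_mul _
          · rw [EventuallyLE, ae_restrict_iff' measurableSet_Ioi]
            refine Eventually.of_forall fun t ht => ?_
            have : 0 < t := hΛ0.trans ht
            show (0 : ℝ) ≤ _
            positivity
      _ ≤ _ := by
          apply ENNReal.ofReal_le_ofReal
          rw [integral_const_mul, integral_Ioi_rpow_of_lt (by norm_num) hΛ0]
          norm_num
          apply le_of_eq
          ring
  have cover : Set.Ioi (0 : ℝ) ⊆ (Set.Ioc 0 (2 * δ) ∪ Set.Ioc (2 * δ) Λ) ∪ Set.Ioi Λ := by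
    intro t ht
    simp only [Set.mem_union, Set.mem_Ioc, Set.mem_Ioi] at *
    by_cases h1 : t ≤ 2 * δ
    · exact Or.inl (Or.inl ⟨ht, h1⟩)
    · by_cases h2 : t ≤ Λ
      · exact Or.inl (Or.inr ⟨not_le.1 h1, h2⟩)
      · exact Or.inr (not_le.1 h2)
  have hΛ0 : 0 < Λ := by linarith
  have hr : 0 < Λ ^ (-(1 / 3) : ℝ) := by positivity
  rw [l3]
  calc ENNReal.ofReal 3 * ∫⁻ t in Set.Ioi 0, D t * ENNReal.ofReal (t ^ ((3 : ℝ) - 1))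
      ≤ ENNReal.ofReal 3 * ((ENNReal.ofReal δ + ENNReal.ofReal (4 * ε ^ 2 * Λ))
          + ENNReal.ofReal (3 * C₁ * Λ ^ (-(1 / 3) : ℝ))) := by
        gcongr
        refine (lintegral_mono_set cover).trans ?_
        refine (lintegral_union_le _ _ _).trans ?_
        gcongr
        refine (lintegral_union_le _ _ _).trans ?_
        gcongr
    _ = ENNReal.ofReal (3 * (δ + 4 * ε ^ 2 * Λ + 3 * C₁ * Λ ^ (-(1 / 3) : ℝ))) := by
        rw [← ENNReal.ofReal_add hδ.le (by positivity),
          ← ENNReal.ofReal_add (by positivity) (by positivity),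
          ← ENNReal.ofReal_mul (by norm_num)]
    _ ≤ _ := by
        apply ENNReal.ofReal_le_ofReal
        have : 0 < ε ^ 2 * Λ := by positivity
        nlinarith [mul_pos hC₁ hδ, mul_pos hC₁ this, mul_pos hC₁ hr]

theorem fn_add (u v : H1 N) : fn (u + v) = fn u + fn v := rfl
theorem fn_smul (c : ℂ) (u : H1 N) : fn (c • u) = c • fn u := rfl
theorem fn_real_smul (c : ℝ) (u : H1 N) : fn (c • u) = (c : ℂ) • fn u := rfl
theorem grad_add (u v : H1 N) : grad (u + v) = grad u + grad v := rfl
theorem grad_smul (c : ℂ) (u : H1 N) : grad (c • u) = c • grad u := rfl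
theorem grad_real_smul (c : ℝ) (u : H1 N) : grad (c • u) = (c : ℂ) • grad u := rfl

theorem H1.norm_sq_eq (u : H1 N) : ‖u‖ ^ 2 = ‖fn u‖ ^ 2 + ‖grad u‖ ^ 2 := by
  rw [Submodule.coe_norm, WithLp.prod_norm_sq_eq_of_L2]; rfl

theorem norm_fn_le (u : H1 N) : ‖fn u‖ ≤ ‖u‖ := by
  have := H1.norm_sq_eq u
  exact le_of_sq_le_sq (by nlinarith [sq_nonneg ‖grad u‖]) (norm_nonneg _)

theorem norm_grad_le (u : H1 N) : ‖grad u‖ ≤ ‖u‖ := by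
  have := H1.norm_sq_eq u
  exact le_of_sq_le_sq (by nlinarith [sq_nonneg ‖fn u‖]) (norm_nonneg _)

theorem ballAvg_congr {ε : ℝ} {f g : Space N → ℂ} (h : f =ᵐ[volume] g) (x : Space N) :
    ballAvg ε f x = ballAvg ε g x := by
  apply integral_congr_ae
  apply (ballMeasure_absolutelyContinuous N ε).ae_le
  exact (measurePreserving_add_left (volume : Measure (Space N)) x).quasiMeasurePreserving.ae h

theorem ballAvg_smul (ε : ℝ) (c : ℂ) (f : L2 N) (x : Space N) :
    ballAvg ε (c • f : L2 N) x = c * ballAvg ε f x := by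
  rw [ballAvg_congr (Lp.coeFn_smul c f) x, ballAvg, ballAvg, ← integral_const_mul]
  rfl

theorem lintegral_cube_smul (c : ℂ) (f : L2 N) :
    ∫⁻ x, ‖(c • f : L2 N) x‖ₑ ^ 3 = ‖c‖ₑ ^ 3 * ∫⁻ x, ‖f x‖ₑ ^ 3 := by
  rw [← lintegral_const_mul' _ _ (by simp)]
  apply lintegral_congr_ae
  filter_upwards [Lp.coeFn_smul c f] with x hx
  rw [hx, Pi.smul_apply, enorm_smul, mul_pow]

theorem exists_lintegral_cube_le_of_norm_le (hN : N = 2 ∨ N = 3) : ∃ C : ℝ, 0 < C ∧ ∀ u : H1 N,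
    ∀ R : ℝ, 0 < R → ‖u‖ ≤ R → ∀ ε δ Λ : ℝ, 0 < ε → 0 < δ → 1 ≤ Λ →
      (∀ x, ‖ballAvg ε (fn u) x‖ ≤ R * δ) →
      ∫⁻ x, ‖fn u x‖ₑ ^ 3
        ≤ ENNReal.ofReal (R ^ 3 * (C * (δ + ε ^ 2 * Λ + Λ ^ (-(1 / 3) : ℝ)))) := by
  obtain ⟨C, hC, h⟩ := exists_lintegral_cube_le hN
  refine ⟨C, hC, fun u R hR hu ε δ Λ hε hδ hΛ ha => ?_⟩
  have hRc : (R : ℂ) ≠ 0 := by exact_mod_cast hR.ne'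
  have hnR : ‖((R : ℂ))⁻¹‖ = R⁻¹ := by
    rw [norm_inv, Complex.norm_real, Real.norm_of_nonneg hR.le]
  have bnd (y : ℝ) (hy : y ≤ R) : R⁻¹ * y ≤ 1 := by
    rw [inv_mul_le_iff₀ hR]; linarith
  have := h ((R : ℂ)⁻¹ • u) (by
      rw [fn_smul, norm_smul, hnR]; exact bnd _ ((norm_fn_le u).trans hu)) (by
      rw [grad_smul, norm_smul, hnR]; exact bnd _ ((norm_grad_le u).trans hu))
    ε δ Λ hε hδ hΛ (fun x => by
      rw [fn_smul, ballAvg_smul, norm_mul, hnR, inv_mul_le_iff₀ hR]; exact ha x)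
  have e : fn u = (R : ℂ) • fn ((R : ℂ)⁻¹ • u) := by
    rw [fn_smul, smul_smul, mul_inv_cancel₀ hRc, one_smul]
  rw [e, lintegral_cube_smul, ENNReal.ofReal_mul (by positivity), ENNReal.ofReal_pow hR.le]
  have : ‖(R : ℂ)‖ₑ = ENNReal.ofReal R := by
    rw [← ofReal_norm, Complex.norm_real, Real.norm_of_nonneg hR.le]
  rw [this]
  gcongr

/-- The Sobolev inequality `‖f‖_{L³}³ ≤ C ‖f‖_{H¹}³` in dimensions two and three. -/
theorem exists_sobolev_cube (hN : N = 2 ∨ N = 3) : ∃ C : ℝ, 0 < C ∧ ∀ u : H1 N,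
    ∫⁻ x, ‖fn u x‖ₑ ^ 3 ≤ ENNReal.ofReal (C * ‖u‖ ^ 3) := by
  obtain ⟨C, hC, h⟩ := exists_lintegral_cube_le_of_norm_le hN
  have hV : 0 < volume.real (ball (0 : Space N) 1) :=
    ENNReal.toReal_pos (measure_ball_pos _ _ one_pos).ne' measure_ball_lt_top.ne
  set V := volume.real (ball (0 : Space N) 1)
  -- At radius one every average is at most ‖f‖/√V, so δ = √(1/V) is admissible with ε = Λ = 1.
  have hs : 0 < √(1 / V) := by positivity
  refine ⟨C * (√(1 / V) + 1 ^ 2 * 1 + 1 ^ (-(1 / 3) : ℝ)), by positivity, fun u => ?_⟩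
  rcases eq_or_ne u 0 with rfl | hu
  · have : (fn (0 : H1 N)) =ᵐ[volume] 0 := Lp.coeFn_zero _ _ _
    have e : ∫⁻ x, ‖fn (0 : H1 N) x‖ₑ ^ 3 = 0 := by
      rw [lintegral_congr_ae (g := fun _ => 0)]
      · simp
      · filter_upwards [this] with x hx
        simp [hx]
    rw [e]; exact zero_le
  · have hu0 : 0 < ‖u‖ := norm_pos_iff.2 hu
    refine (h u ‖u‖ hu0 le_rfl 1 (√(1 / V)) 1 one_pos hs le_rfl fun x => ?_).trans
      (le_of_eq ?_)
    · have := norm_ballAvg_sq_le (fn u) one_pos x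
      refine le_of_sq_le_sq (this.trans ?_) (by positivity)
      rw [mul_pow, Real.sq_sqrt (by positivity), one_pow, one_mul, mul_one_div]
      have := norm_fn_le u
      gcongr
    · congr 1; ring

theorem memLp_three (hN : N = 2 ∨ N = 3) (u : H1 N) : MemLp (fn u) 3 volume := by
  obtain ⟨C, -, h⟩ := exists_sobolev_cube hN
  refine ⟨(Lp.stronglyMeasurable (fn u)).aestronglyMeasurable, ?_⟩
  rw [eLpNorm_lt_top_iff_lintegral_rpow_enorm_lt_top (by simp) (by simp)]
  simp only [ENNReal.toReal_ofNat, ENNReal.rpow_ofNat]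
  exact (h u).trans_lt ENNReal.ofReal_lt_top

theorem integrable_cube (hN : N = 2 ∨ N = 3) (u : H1 N) :
    Integrable (fun x => ‖fn u x‖ ^ 3) volume := by
  have := (memLp_three hN u).integrable_norm_rpow (by simp) (by simp)
  simpa using this

theorem integral_cube_le_of_lintegral {f : L2 N} {B : ℝ} (hB : 0 ≤ B)
    (h : ∫⁻ x, ‖f x‖ₑ ^ 3 ≤ ENNReal.ofReal B) : ∫ x, ‖f x‖ ^ 3 ≤ B := by
  rw [integral_eq_lintegral_of_nonneg_ae (f := fun x => ‖f x‖ ^ 3) (Eventually.of_forall fun x => by positivity)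
    ((Lp.stronglyMeasurable f).norm.pow 3).aestronglyMeasurable]
  refine ENNReal.toReal_le_of_le_ofReal hB (le_trans (le_of_eq ?_) h)
  congr 1; ext x
  rw [ENNReal.ofReal_pow (norm_nonneg _), ofReal_norm]

theorem exists_integral_cube_le (hN : N = 2 ∨ N = 3) : ∃ C : ℝ, 0 < C ∧ ∀ u : H1 N,
    ∫ x, ‖fn u x‖ ^ 3 ≤ C * ‖u‖ ^ 3 := by
  obtain ⟨C, hC, h⟩ := exists_sobolev_cube hN
  exact ⟨C, hC, fun u => integral_cube_le_of_lintegral (by positivity) (h u)⟩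

/-- A bounded sequence in `H¹` all of whose averages over balls vanish uniformly tends to zero
in `L³`. -/
theorem exists_forall_ballAvg_le_imp (hN : N = 2 ∨ N = 3) {R η : ℝ} (hR : 0 < R) (hη : 0 < η) :
    ∃ ε δ : ℝ, 0 < ε ∧ 0 < δ ∧ ∀ u : H1 N, ‖u‖ ≤ R →
      (∀ x, ‖ballAvg ε (fn u) x‖ ≤ δ) → ∫ x, ‖fn u x‖ ^ 3 ≤ η := by
  obtain ⟨C, hC, h⟩ := exists_lintegral_cube_le_of_norm_le hN
  -- Each of the three terms of the cubic bound is to be at most κ: Λ is taken large first, then ε²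
  -- = κ/Λ, while δ contributes κ after division by R.
  set κ : ℝ := η / (R ^ 3 * C * 3) with hκ
  have hκ0 : 0 < κ := by positivity
  have ht : Tendsto (fun t : ℝ => t ^ (-(1 / 3) : ℝ)) atTop (𝓝 0) :=
    tendsto_rpow_neg_atTop (by norm_num)
  obtain ⟨Λ, hΛ, hΛ1⟩ := ((ht.eventually (gt_mem_nhds hκ0)).and (eventually_ge_atTop 1)).exists
  have hΛ0 : 0 < Λ := by linarith
  refine ⟨√(κ / Λ), R * κ, by positivity, by positivity, fun u hu ha => ?_⟩
  apply integral_cube_le_of_lintegral hη.le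
  refine (h u R hR hu _ κ Λ (by positivity) hκ0 hΛ1 ha).trans (ENNReal.ofReal_le_ofReal ?_)
  rw [Real.sq_sqrt (by positivity), div_mul_cancel₀ _ hΛ0.ne']
  calc R ^ 3 * (C * (κ + κ + Λ ^ (-(1 / 3) : ℝ))) ≤ R ^ 3 * (C * (κ + κ + κ)) := by gcongr
    _ = η := by rw [hκ]; field_simp; norm_num

/-! ### The trilinear form behind G. -/

theorem mul_mul_le_cubes {x y z : ℝ} (hx : 0 ≤ x) (hy : 0 ≤ y) (hz : 0 ≤ z) :
    x * y * z ≤ x ^ 3 + y ^ 3 + z ^ 3 := by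
  nlinarith [mul_nonneg hx hy, mul_nonneg hy hz, mul_nonneg hx hz, sq_nonneg (x - y),
    sq_nonneg (y - z), sq_nonneg (x - z), pow_nonneg hx 3, pow_nonneg hy 3, pow_nonneg hz 3,
    mul_nonneg (add_nonneg (add_nonneg hx hy) hz) (sq_nonneg (x - y)),
    mul_nonneg (add_nonneg (add_nonneg hx hy) hz) (sq_nonneg (y - z)),
    mul_nonneg (add_nonneg (add_nonneg hx hy) hz) (sq_nonneg (x - z))]

theorem integrable_norm_triple (hN : N = 2 ∨ N = 3) (a b c : H1 N) :
    Integrable (fun x => ‖fn a x‖ * ‖fn b x‖ * ‖fn c x‖) volume := by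
  refine (((integrable_cube hN a).add (integrable_cube hN b)).add (integrable_cube hN c)).mono'
    (((Lp.stronglyMeasurable (fn a)).norm.mul (Lp.stronglyMeasurable (fn b)).norm).mul
      (Lp.stronglyMeasurable (fn c)).norm).aestronglyMeasurable (Eventually.of_forall fun x => ?_)
  rw [Real.norm_of_nonneg (by positivity)]
  exact mul_mul_le_cubes (norm_nonneg _) (norm_nonneg _) (norm_nonneg _)

/-- `∫ |a| |b| |c|`. -/
def absTriple (a b c : H1 N) : ℝ := ∫ x, ‖fn a x‖ * ‖fn b x‖ * ‖fn c x‖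

theorem absTriple_nonneg (a b c : H1 N) : 0 ≤ absTriple a b c :=
  integral_nonneg fun x => by positivity

theorem absTriple_le_cubes (hN : N = 2 ∨ N = 3) (a b c : H1 N) : absTriple a b c
    ≤ (∫ x, ‖fn a x‖ ^ 3) + (∫ x, ‖fn b x‖ ^ 3) + ∫ x, ‖fn c x‖ ^ 3 := by
  have ia := integrable_cube hN a
  have ib := integrable_cube hN b
  have ic := integrable_cube hN c
  have e : ∫ x, (‖fn a x‖ ^ 3 + ‖fn b x‖ ^ 3 + ‖fn c x‖ ^ 3)
      = (∫ x, ‖fn a x‖ ^ 3) + (∫ x, ‖fn b x‖ ^ 3) + ∫ x, ‖fn c x‖ ^ 3 := by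
    rw [← integral_add ia ib]
    exact integral_add (ia.add ib) ic
  rw [← e]
  exact integral_mono (integrable_norm_triple hN a b c) ((ia.add ib).add ic) fun x =>
    mul_mul_le_cubes (norm_nonneg _) (norm_nonneg _) (norm_nonneg _)

theorem absTriple_comm (a b c : H1 N) : absTriple a b c = absTriple a c b := by
  unfold absTriple; congr 1; ext x; ring

theorem absTriple_swap (a b c : H1 N) : absTriple a b c = absTriple b a c := by
  unfold absTriple; congr 1; ext x; ring

theorem absTriple_zero_left (b c : H1 N) : absTriple 0 b c = 0 := by
  have h0 : (fn (0 : H1 N)) =ᵐ[volume] 0 := Lp.coeFn_zero _ _ _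
  have : absTriple 0 b c = ∫ _ : Space N, (0 : ℝ) := by
    apply integral_congr_ae
    filter_upwards [h0] with x hx
    simp [hx]
  simpa using this

theorem absTriple_smul_left (s : ℂ) (a b c : H1 N) :
    absTriple (s • a) b c = ‖s‖ * absTriple a b c := by
  unfold absTriple
  rw [← integral_const_mul]
  apply integral_congr_ae
  filter_upwards [Lp.coeFn_smul s (fn a)] with x hx
  rw [fn_smul, hx, Pi.smul_apply, norm_smul]
  ring

/-- On unit balls the sum of the three cubes is bounded; homogeneity, used in one slot at a time,
turns this into a product bound. -/
theorem exists_absTriple_le (hN : N = 2 ∨ N = 3) : ∃ C : ℝ, 0 < C ∧ ∀ a b c : H1 N,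
    absTriple a b c ≤ C * ‖a‖ * ‖b‖ * ‖c‖ := by
  obtain ⟨C, hC, h⟩ := exists_integral_cube_le hN
  have unit : ∀ a b c : H1 N, ‖a‖ ≤ 1 → ‖b‖ ≤ 1 → ‖c‖ ≤ 1 → absTriple a b c ≤ 3 * C := by
    intro a b c ha hb hc
    have key (u : H1 N) (hu : ‖u‖ ≤ 1) : ∫ x, ‖fn u x‖ ^ 3 ≤ C := by
      have := pow_le_one₀ (n := 3) (norm_nonneg u) hu
      nlinarith [h u]
    linarith [absTriple_le_cubes hN a b c, key a ha, key b hb, key c hc]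
  have step (a b c : H1 N) (B : ℝ) (hB : ∀ a' : H1 N, ‖a'‖ ≤ 1 → absTriple a' b c ≤ B) :
      absTriple a b c ≤ ‖a‖ * B := by
    rcases eq_or_ne a 0 with rfl | ha
    · simp [absTriple_zero_left]
    · have ha0 : 0 < ‖a‖ := norm_pos_iff.2 ha
      have hn : ‖((‖a‖ : ℂ))⁻¹‖ = ‖a‖⁻¹ := by simp
      have := hB (((‖a‖ : ℂ))⁻¹ • a) (by
        rw [norm_smul, hn, inv_mul_cancel₀ ha0.ne'])
      rw [absTriple_smul_left, hn, inv_mul_le_iff₀ ha0] at this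
      exact this
  refine ⟨3 * C, by positivity, fun a b c => ?_⟩
  have s1 : ∀ a b c : H1 N, ‖b‖ ≤ 1 → ‖c‖ ≤ 1 → absTriple a b c ≤ ‖a‖ * (3 * C) :=
    fun a b c hb hc => step a b c _ fun a' ha' => unit a' b c ha' hb hc
  have s2 : ∀ a b c : H1 N, ‖c‖ ≤ 1 → absTriple a b c ≤ ‖b‖ * (‖a‖ * (3 * C)) := by
    intro a b c hc
    rw [absTriple_swap]
    exact step b a c _ fun b' hb' => by rw [absTriple_swap]; exact s1 a b' c hb' hc
  have s3 : absTriple a b c ≤ ‖c‖ * (‖b‖ * (‖a‖ * (3 * C))) := by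
    rw [absTriple_comm, absTriple_swap]
    exact step c a b _ fun c' hc' => by
      rw [absTriple_swap, absTriple_comm]; exact s2 a b c' hc'
  linarith

/-- The trilinear form `Re ∫ a b \bar c`. -/
def triple (a b c : H1 N) : ℝ := (∫ x, fn a x * fn b x * conj (fn c x)).re

theorem integrable_triple (hN : N = 2 ∨ N = 3) (a b c : H1 N) :
    Integrable (fun x => fn a x * fn b x * conj (fn c x)) volume :=
  (integrable_norm_triple hN a b c).mono'
    (((Lp.stronglyMeasurable (fn a)).mul (Lp.stronglyMeasurable (fn b))).mul
      (continuous_star.comp_stronglyMeasurable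
        (Lp.stronglyMeasurable (fn c)))).aestronglyMeasurable
    (Eventually.of_forall fun x => by simp)

theorem abs_triple_le (a b c : H1 N) : |triple a b c| ≤ absTriple a b c := by
  refine (Complex.abs_re_le_norm _).trans ((norm_integral_le_integral_norm _).trans (le_of_eq ?_))
  simp [absTriple]

theorem triple_comm (a b c : H1 N) : triple a b c = triple b a c := by
  unfold triple; congr 2; ext x; ring

theorem triple_add_left (hN : N = 2 ∨ N = 3) (a a' b c : H1 N) :
    triple (a + a') b c = triple a b c + triple a' b c := by
  unfold triple
  rw [← Complex.add_re, ← integral_add (integrable_triple hN a b c) (integrable_triple hN a' b c)]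
  congr 1
  apply integral_congr_ae
  filter_upwards [Lp.coeFn_add (fn a) (fn a')] with x hx
  rw [fn_add, hx, Pi.add_apply]
  ring

theorem triple_add_right (hN : N = 2 ∨ N = 3) (a b c c' : H1 N) :
    triple a b (c + c') = triple a b c + triple a b c' := by
  unfold triple
  rw [← Complex.add_re, ← integral_add (integrable_triple hN a b c) (integrable_triple hN a b c')]
  congr 1
  apply integral_congr_ae
  filter_upwards [Lp.coeFn_add (fn c) (fn c')] with x hx
  rw [fn_add, hx, Pi.add_apply, map_add]
  ring

theorem triple_smul_left (s : ℝ) (a b c : H1 N) : triple (s • a) b c = s * triple a b c := by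
  unfold triple
  rw [← Complex.re_ofReal_mul, ← integral_const_mul]
  congr 1
  apply integral_congr_ae
  filter_upwards [Lp.coeFn_smul (s : ℂ) (fn a)] with x hx
  rw [fn_real_smul, hx, Pi.smul_apply, smul_eq_mul]
  ring

theorem triple_smul_right (s : ℝ) (a b c : H1 N) : triple a b (s • c) = s * triple a b c := by
  unfold triple
  rw [← Complex.re_ofReal_mul, ← integral_const_mul]
  congr 1
  apply integral_congr_ae
  filter_upwards [Lp.coeFn_smul (s : ℂ) (fn c)] with x hx
  rw [fn_real_smul, hx, Pi.smul_apply, smul_eq_mul, map_mul, Complex.conj_ofReal]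
  ring

theorem G_eq_triple (u : H1Pair N) : G u = triple u.1 u.1 u.2 := by
  unfold G triple; congr 2; ext x; ring

theorem triple_add_add_add (hN : N = 2 ∨ N = 3) (a b p q : H1 N) :
    triple (a + p) (a + p) (b + q) = triple a a b + (2 * triple a p b + triple a a q)
      + (triple p p b + 2 * triple a p q) + triple p p q := by
  have e (c : H1 N) : triple (a + p) (a + p) c
      = triple a a c + 2 * triple a p c + triple p p c := by
    rw [triple_add_left hN a p (a + p) c, triple_comm a (a + p) c, triple_comm p (a + p) c,
      triple_add_left hN a p a c, triple_add_left hN a p p c, triple_comm p a c]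
    ring
  rw [triple_add_right hN, e, e]
  ring

theorem G_add (hN : N = 2 ∨ N = 3) (u h : H1Pair N) : G (u + h) = G u
    + (2 * triple u.1 h.1 u.2 + triple u.1 u.1 h.2)
    + (triple h.1 h.1 u.2 + 2 * triple u.1 h.1 h.2) + G h := by
  rw [G_eq_triple (u + h), G_eq_triple u, G_eq_triple h]
  exact triple_add_add_add hN u.1 u.2 h.1 h.2

theorem G_smul (s : ℝ) (u : H1Pair N) : G (s • u) = s ^ 3 * G u := by
  simp only [G_eq_triple, Prod.smul_fst, Prod.smul_snd]
  rw [triple_smul_right, triple_smul_left, triple_comm, triple_smul_left]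
  ring

/-! ### Translations and dilations. -/

theorem map_affine (N : ℕ) {s : ℝ} (hs : 0 < s) (y : Space N) :
    Measure.map (fun x : Space N => s • x + y) volume
      = ENNReal.ofReal ((s ^ N)⁻¹) • (volume : Measure (Space N)) := by
  have h1 := Measure.map_addHaar_smul (volume : Measure (Space N)) hs.ne'
  have h2 : Measure.map (fun x : Space N => x + y) volume = volume :=
    (measurePreserving_add_right (volume : Measure (Space N)) y).map_eq
  have h3 : (fun x : Space N => s • x + y) = (fun x => x + y) ∘ (fun x => s • x) := rfl
  rw [h3, ← Measure.map_map (by fun_prop) (by fun_prop), h1, Measure.map_smul, h2]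
  simp [abs_of_pos hs]

theorem integral_comp_affine {F : Type*} [NormedAddCommGroup F] [NormedSpace ℝ F] {s : ℝ}
    (hs : 0 < s) (y : Space N) (f : Space N → F) :
    ∫ x, f (s • x + y) = (s ^ N)⁻¹ • ∫ x, f x := by
  have := Measure.integral_comp_smul (volume : Measure (Space N)) (fun x => f (x + y)) s
  rw [this, integral_add_right_eq_self]
  simp [abs_of_pos hs]

theorem memLp_comp_affine {F : Type*} [NormedAddCommGroup F] {s : ℝ} (hs : 0 < s) (y : Space N)
    {f : Space N → F} {p : ℝ≥0∞} (hf : MemLp f p volume) :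
    MemLp (fun x => f (s • x + y)) p volume := by
  refine MemLp.comp_of_map (f := fun x : Space N => s • x + y) ?_ (by fun_prop)
  rw [map_affine N hs y]
  exact hf.smul_measure ENNReal.ofReal_ne_top

theorem norm_sq_eq_integral {X F : Type*} [MeasurableSpace X] [NormedAddCommGroup F]
    {μ : Measure X} (f : Lp F 2 μ) : ‖f‖ ^ 2 = ∫ x, ‖f x‖ ^ 2 ∂μ := by
  rw [integral_eq_lintegral_of_nonneg_ae (f := fun x => ‖f x‖ ^ 2)
    (Eventually.of_forall fun x => by positivity)
    ((Lp.stronglyMeasurable f).norm.pow 2).aestronglyMeasurable]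
  have := lintegral_enorm_sq_eq f
  simp only [ENNReal.ofReal_pow (norm_nonneg _), ofReal_norm] at this ⊢
  rw [this]
  simp

theorem IsWeakGradient.comp_affine {f : Space N → ℂ} {g : Space N → EuclideanSpace ℂ (Fin N)}
    (H : IsWeakGradient f g) {s : ℝ} (hs : 0 < s) (y : Space N) :
    IsWeakGradient (fun x => f (s • x + y)) (fun x => (s : ℂ) • g (s • x + y)) := by
  intro η hη hc j
  set θ : Space N → ℝ := fun z => η (s⁻¹ • (z - y)) with hθ
  have inv (x : Space N) : s⁻¹ • (s • x + y - y) = x := by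
    rw [add_sub_cancel_right, smul_smul, inv_mul_cancel₀ hs.ne', one_smul]
  have θs : ContDiff ℝ (⊤ : ℕ∞) θ :=
    hη.comp ((contDiff_id.sub contDiff_const).const_smul s⁻¹)
  have θc : HasCompactSupport θ :=
    hc.comp_homeomorph ((Homeomorph.subRight y).trans (Homeomorph.smulOfNeZero s⁻¹ (by positivity)))
  have hd (x v : Space N) : fderiv ℝ η x v = s * fderiv ℝ θ (s • x + y) v := by
    have e : HasFDerivAt θ ((fderiv ℝ η x).comp (s⁻¹ • ContinuousLinearMap.id ℝ (Space N)))
        (s • x + y) := by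
      have h1 : HasFDerivAt (fun z : Space N => s⁻¹ • (z - y))
          (s⁻¹ • ContinuousLinearMap.id ℝ (Space N)) (s • x + y) :=
        ((hasFDerivAt_id _).sub_const y).const_smul s⁻¹
      have h2 : HasFDerivAt η (fderiv ℝ η x) (s⁻¹ • (s • x + y - y)) := by
        rw [inv]; exact (hη.differentiable (by simp) x).hasFDerivAt
      exact h2.comp (s • x + y) h1
    rw [e.fderiv]
    simp [hs.ne']
  have h1 : ∫ x, (fderiv ℝ η x (EuclideanSpace.single j 1)) • f (s • x + y)
      = (s ^ N)⁻¹ • (s • ∫ z, (fderiv ℝ θ z (EuclideanSpace.single j 1)) • f z) := by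
    rw [← integral_smul s, ← integral_comp_affine hs y]
    simp only [hd, mul_smul]
  have h2 : ∫ x, η x • ((s : ℂ) • g (s • x + y)) j
      = (s ^ N)⁻¹ • (s • ∫ z, θ z • g z j) := by
    rw [← integral_smul s, ← integral_comp_affine hs y]
    congr 1; ext x
    simp only [hθ, inv, PiLp.smul_apply, Complex.real_smul, smul_eq_mul]
    ring
  rw [h1, h2, H θ θs θc j, smul_neg, smul_neg]

theorem exists_affine (u : H1 N) {s : ℝ} (hs : 0 < s) (y : Space N) :
    ∃ u' : H1 N, fn u' =ᵐ[volume] (fun x => fn u (s • x + y)) ∧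
      ‖fn u'‖ ^ 2 = (s ^ N)⁻¹ * ‖fn u‖ ^ 2 ∧
      ‖grad u'‖ ^ 2 = (s ^ N)⁻¹ * (s ^ 2 * ‖grad u‖ ^ 2) := by
  have mf := memLp_comp_affine hs y (Lp.memLp (fn u))
  have mg : MemLp (fun x => (s : ℂ) • grad u (s • x + y)) 2 volume :=
    (memLp_comp_affine hs y (Lp.memLp (grad u))).const_smul (s : ℂ)
  have ef := mf.coeFn_toLp
  have eg := mg.coeFn_toLp
  have hw : IsWeakGradient (mf.toLp _) (mg.toLp _) := by
    intro η hη hc j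
    have := (H1.isWeakGradient u).comp_affine hs y η hη hc j
    refine Eq.trans (integral_congr_ae ?_) (this.trans (congrArg _ (integral_congr_ae ?_)))
    · filter_upwards [ef] with x hx
      rw [hx]
    · filter_upwards [eg] with x hx
      rw [hx]
  refine ⟨⟨WithLp.toLp 2 (mf.toLp _, mg.toLp _), hw⟩, ef, ?_, ?_⟩
  · show ‖mf.toLp _‖ ^ 2 = _
    rw [norm_sq_eq_integral, norm_sq_eq_integral, ← smul_eq_mul,
      ← integral_comp_affine hs y (fun x => ‖fn u x‖ ^ 2)]
    apply integral_congr_ae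
    filter_upwards [ef] with x hx
    rw [hx]
  · show ‖mg.toLp _‖ ^ 2 = _
    rw [norm_sq_eq_integral, norm_sq_eq_integral, ← integral_const_mul, ← smul_eq_mul,
      ← integral_comp_affine hs y (fun x => s ^ 2 * ‖grad u x‖ ^ 2)]
    apply integral_congr_ae
    filter_upwards [eg] with x hx
    rw [hx, norm_smul, mul_pow, Complex.norm_real, Real.norm_eq_abs, sq_abs]

/-- The pair `u(s · + y)`. -/
theorem exists_affine_pair (u : H1Pair N) {s : ℝ} (hs : 0 < s) (y : Space N) :
    ∃ w : H1Pair N, fn w.1 =ᵐ[volume] (fun x => fn u.1 (s • x + y)) ∧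
      fn w.2 =ᵐ[volume] (fun x => fn u.2 (s • x + y)) ∧
      ‖fn w.1‖ ^ 2 = (s ^ N)⁻¹ * ‖fn u.1‖ ^ 2 ∧ ‖fn w.2‖ ^ 2 = (s ^ N)⁻¹ * ‖fn u.2‖ ^ 2 ∧
      ‖grad w.1‖ ^ 2 = (s ^ N)⁻¹ * (s ^ 2 * ‖grad u.1‖ ^ 2) ∧
      ‖grad w.2‖ ^ 2 = (s ^ N)⁻¹ * (s ^ 2 * ‖grad u.2‖ ^ 2) ∧ G w = (s ^ N)⁻¹ * G u := by
  obtain ⟨w₁, e₁, f₁, g₁⟩ := exists_affine u.1 hs y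
  obtain ⟨w₂, e₂, f₂, g₂⟩ := exists_affine u.2 hs y
  refine ⟨(w₁, w₂), e₁, e₂, f₁, f₂, g₁, g₂, ?_⟩
  have : ∫ x, (fn w₁ x) ^ 2 * conj (fn w₂ x)
      = (s ^ N)⁻¹ • ∫ x, (fn u.1 x) ^ 2 * conj (fn u.2 x) := by
    rw [← integral_comp_affine hs y]
    apply integral_congr_ae
    filter_upwards [e₁, e₂] with x h1 h2
    rw [h1, h2]
  show (∫ x, (fn w₁ x) ^ 2 * conj (fn w₂ x)).re = _
  rw [this, Complex.smul_re, smul_eq_mul]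
  rfl

/-! ### Weak convergence and local compactness. -/

/-- Weak convergence of a sequence in a complex Hilbert space. -/
def WeakTendsto {F : Type*} [NormedAddCommGroup F] [InnerProductSpace ℂ F] (x : ℕ → F) (y : F) :
    Prop :=
  ∀ z : F, Tendsto (fun n => inner ℂ z (x n)) atTop (𝓝 (inner ℂ z y))

/-- Sequential Banach–Alaoglu in the dual, carried back by the Riesz isometry; that isometry is
conjugate linear, hence the final conjugation. -/
theorem exists_subseq_weakTendsto {F : Type*} [NormedAddCommGroup F] [InnerProductSpace ℂ F]
    [CompleteSpace F] [TopologicalSpace.SeparableSpace F] {x : ℕ → F} {R : ℝ}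
    (hx : ∀ n, ‖x n‖ ≤ R) : ∃ y : F, ∃ φ : ℕ → ℕ, StrictMono φ ∧ WeakTendsto (x ∘ φ) y := by
  let T : F → WeakDual ℂ F := fun v =>
    StrongDual.toWeakDual (InnerProductSpace.toDual ℂ F v)
  have hT (v z : F) : T v z = inner ℂ v z := rfl
  have hc := WeakDual.isSeqCompact_closedBall ℂ F (0 : StrongDual ℂ F) R
  have hmem : ∀ n, T (x n) ∈ WeakDual.toStrongDual ⁻¹' closedBall (0 : StrongDual ℂ F) R := by
    intro n
    rw [Set.mem_preimage, mem_closedBall_zero_iff]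
    exact ((InnerProductSpace.toDual ℂ F).norm_map (x n)).trans_le (hx n)
  obtain ⟨f, -, φ, hφ, hlim⟩ := hc hmem
  obtain ⟨y, hy⟩ := (InnerProductSpace.toDual ℂ F).surjective (WeakDual.toStrongDual f)
  refine ⟨y, φ, hφ, fun z => ?_⟩
  have h1 : Tendsto (fun n => T (x (φ n)) z) atTop (𝓝 (f z)) :=
    ((WeakDual.eval_continuous z).tendsto f).comp hlim
  have h2 : f z = inner ℂ y z := by
    have : (InnerProductSpace.toDual ℂ F y) z = f z := by rw [hy]; rfl
    rw [← this]; rfl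
  rw [h2] at h1
  have h3 := (continuous_star.tendsto _).comp h1
  refine (h3.congr fun n => ?_).trans (le_of_eq ?_)
  · exact inner_conj_symm (𝕜 := ℂ) z (x (φ n))
  · congr 1; exact inner_conj_symm (𝕜 := ℂ) z y

theorem WeakTendsto.subseq {F : Type*} [NormedAddCommGroup F] [InnerProductSpace ℂ F]
    {x : ℕ → F} {y : F} (h : WeakTendsto x y) {φ : ℕ → ℕ} (hφ : StrictMono φ) :
    WeakTendsto (x ∘ φ) y := fun z => (h z).comp hφ.tendsto_atTop

theorem WeakTendsto.sub_const {F : Type*} [NormedAddCommGroup F] [InnerProductSpace ℂ F]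
    {x : ℕ → F} {y : F} (h : WeakTendsto x y) : WeakTendsto (fun n => x n - y) 0 := fun z => by
  have := (h z).sub_const (inner ℂ z y)
  simpa [inner_sub_right] using this

theorem integral_smul_eq_inner {η : Space N → ℝ} (hη : MemLp (fun x => (η x : ℂ)) 2 volume)
    (f : L2 N) : ∫ x, η x • f x = inner ℂ (hη.toLp _) f := by
  rw [L2.inner_def]
  apply integral_congr_ae
  filter_upwards [hη.coeFn_toLp] with x hx
  rw [hx]
  simp [mul_comm]

theorem integral_smul_coord_eq_inner {η : Space N → ℝ} (j : Fin N)
    (hη : MemLp (fun x => EuclideanSpace.single j (η x : ℂ)) 2 volume)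
    (g : L2Vec N) : ∫ x, η x • g x j = inner ℂ (hη.toLp _) g := by
  rw [L2.inner_def]
  apply integral_congr_ae
  filter_upwards [hη.coeFn_toLp] with x hx
  rw [hx, EuclideanSpace.inner_single_left]
  simp

/-- Weak gradients pass to weak limits. -/
theorem IsWeakGradient.of_weakTendsto {u : ℕ → H1 N} {f : L2 N} {g : L2Vec N}
    (hf : WeakTendsto (fun n => fn (u n)) f) (hg : WeakTendsto (fun n => grad (u n)) g) :
    IsWeakGradient f g := by
  intro η hη hc j
  have m1 : MemLp (fun x => ((fderiv ℝ η x (EuclideanSpace.single j 1) : ℝ) : ℂ)) 2 volume :=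
    (((hη.continuous_fderiv (by simp)).clm_apply
      continuous_const).memLp_of_hasCompactSupport (hc.fderiv_apply ℝ _)).ofReal
  have m2 : MemLp (fun x => EuclideanSpace.single j (η x : ℂ)) 2 volume := by
    have hcont : Continuous (fun x => EuclideanSpace.single j (η x : ℂ)) := by
      have := hη.continuous
      have h : (fun x => EuclideanSpace.single j (η x : ℂ))
          = fun x => (η x : ℂ) • EuclideanSpace.single j (1 : ℂ) := by
        ext x i; simp
      rw [h]
      fun_prop
    exact hcont.memLp_of_hasCompactSupport
      (hc.comp_left (g := fun t : ℝ => EuclideanSpace.single j (t : ℂ)) (by simp))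
  have t1 := hf (m1.toLp _)
  have t2 := (hg (m2.toLp _)).neg
  rw [integral_smul_eq_inner m1, integral_smul_coord_eq_inner j m2]
  refine tendsto_nhds_unique t1 (t2.congr fun n => ?_)
  rw [← integral_smul_eq_inner m1, ← integral_smul_coord_eq_inner j m2]
  exact (H1.isWeakGradient (u n) η hη hc j).symm

theorem exists_subseq_weakTendsto_H1 {u : ℕ → H1 N} {R : ℝ} (hu : ∀ n, ‖u n‖ ≤ R) :
    ∃ v : H1 N, ∃ φ : ℕ → ℕ, StrictMono φ ∧ WeakTendsto (fun n => fn (u (φ n))) (fn v) ∧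
      WeakTendsto (fun n => grad (u (φ n))) (grad v) := by
  have : Fact ((2 : ℝ≥0∞) ≠ ∞) := ⟨by simp⟩
  obtain ⟨f, φ, hφ, hf⟩ := exists_subseq_weakTendsto (x := fun n => fn (u n))
    fun n => (norm_fn_le _).trans (hu n)
  obtain ⟨g, ψ, hψ, hg⟩ := exists_subseq_weakTendsto (x := fun n => grad (u (φ n)))
    fun n => (norm_grad_le _).trans (hu (φ n))
  have hf' : WeakTendsto (fun n => fn (u (φ (ψ n)))) f := hf.subseq hψ
  have hw : IsWeakGradient f g := IsWeakGradient.of_weakTendsto hf' hg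
  exact ⟨⟨WithLp.toLp 2 (f, g), hw⟩, φ ∘ ψ, hφ.comp hψ, hf', hg⟩

/-- An average is a pairing with a normalized indicator, so averages converge pointwise along weakly
convergent sequences. -/
theorem ballAvg_eq_inner (ε : ℝ) (f : L2 N) (x : Space N) :
    ballAvg ε f x = ((volume (ball (0 : Space N) ε))⁻¹).toReal •
      inner ℂ (indicatorConstLp 2 (measurableSet_ball : MeasurableSet (ball x ε))
        (measure_ball_lt_top (μ := volume)).ne (1 : ℂ)) f := by
  rw [L2.inner_indicatorConstLp_one, ballAvg, ballMeasure_def, integral_smul_measure]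
  congr 1
  rw [← integral_indicator measurableSet_ball, ← integral_indicator measurableSet_ball,
    ← integral_add_left_eq_self ((ball x ε).indicator _) x]
  congr 1
  ext h
  simp [Set.indicator, mem_ball, dist_eq_norm]

theorem WeakTendsto.ballAvg {f : ℕ → L2 N} {g : L2 N} (h : WeakTendsto f g) (ε : ℝ)
    (x : Space N) :
    Tendsto (fun n => ballAvg ε (f n) x) atTop (𝓝 (KleinGordon.ballAvg ε g x)) := by
  simp only [ballAvg_eq_inner]
  exact (h _).const_smul _

theorem enorm_sq_le_two_mul {F : Type*} [NormedAddCommGroup F] (x y : F) :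
    ‖x‖ₑ ^ 2 ≤ 2 * ‖x - y‖ₑ ^ 2 + 2 * ‖y‖ₑ ^ 2 := by
  have h : ‖x‖ ^ 2 ≤ 2 * ‖x - y‖ ^ 2 + 2 * ‖y‖ ^ 2 := by
    have : ‖x‖ ≤ ‖x - y‖ + ‖y‖ := by simpa using norm_add_le (x - y) y
    nlinarith [sq_nonneg (‖x - y‖ - ‖y‖), norm_nonneg x]
  have := ENNReal.ofReal_le_ofReal h
  rw [ENNReal.ofReal_add (by positivity) (by positivity), ENNReal.ofReal_mul (by norm_num),
    ENNReal.ofReal_mul (by norm_num)] at this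
  simpa [ENNReal.ofReal_pow] using this

/-- Local strong compactness: weak null sequences bounded in `H¹` tend to zero in `L²(B)`. -/
theorem tendsto_setIntegral_ball_sq {w : ℕ → H1 N} {R : ℝ} (hR : 0 < R) (hw : ∀ n, ‖w n‖ ≤ R)
    (h : WeakTendsto (fun n => fn (w n)) 0) (k : ℝ) {η : ℝ} (hη : 0 < η) :
    ∀ᶠ n in atTop, ∫ x in ball (0 : Space N) k, ‖fn (w n) x‖ ^ 2 ≤ η := by
  -- At this radius the squared L² distance to the averages is at most η/4 along the whole sequence.
  -- The averages themselves tend to zero pointwise and are dominated by a constant on the ball.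
  set ε : ℝ := √(η / 4) / R with hε
  have hε0 : 0 < ε := by positivity
  have hsm (n : ℕ) := stronglyMeasurable_ballAvg (fn (w n)) hε0
  have lim : Tendsto (fun n => ∫⁻ x in ball (0 : Space N) k, ‖ballAvg ε (fn (w n)) x‖ₑ ^ 2) atTop
      (𝓝 (∫⁻ x in ball (0 : Space N) k, 0)) := by
    refine tendsto_lintegral_of_dominated_convergence
      (fun _ => (volume (ball (0 : Space N) ε))⁻¹ * ENNReal.ofReal (R ^ 2)) ?_ ?_ ?_ ?_
    · exact fun n => (hsm n).enorm.pow_const 2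
    · refine fun n => Eventually.of_forall fun x => (enorm_ballAvg_sq_le _ hε0 x).trans ?_
      have : ‖fn (w n)‖ ^ 2 ≤ R ^ 2 := by
        gcongr
        exact (norm_fn_le _).trans (hw n)
      exact mul_le_mul_right (ENNReal.ofReal_le_ofReal this) _
    · rw [setLIntegral_const]
      exact ENNReal.mul_ne_top (ENNReal.mul_ne_top
        (ENNReal.inv_ne_top.2 (measure_ball_pos _ _ hε0).ne') ENNReal.ofReal_ne_top)
        measure_ball_lt_top.ne
    · refine Eventually.of_forall fun x => ?_
      have h0 := h.ballAvg ε x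
      have e : KleinGordon.ballAvg ε (0 : L2 N) x = 0 := by
        rw [ballAvg_congr (Lp.coeFn_zero _ _ _) x]; simp [KleinGordon.ballAvg]
      rw [e] at h0
      have := (ENNReal.continuous_pow 2).tendsto _ |>.comp h0.enorm
      rw [enorm_zero, zero_pow two_ne_zero] at this
      exact this
  rw [lintegral_zero] at lim
  have hη4 : (0 : ℝ≥0∞) < ENNReal.ofReal (η / 4) := ENNReal.ofReal_pos.2 (by positivity)
  filter_upwards [lim.eventually (gt_mem_nhds hη4)] with n hn
  rw [integral_eq_lintegral_of_nonneg_ae (f := fun x => ‖fn (w n) x‖ ^ 2)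
    (Eventually.of_forall fun x => by positivity)
    ((Lp.stronglyMeasurable (fn (w n))).norm.pow 2).aestronglyMeasurable]
  apply ENNReal.toReal_le_of_le_ofReal hη.le
  have m1 : Measurable fun x => ‖fn (w n) x - ballAvg ε (fn (w n)) x‖ₑ ^ 2 :=
    ((Lp.stronglyMeasurable (fn (w n))).sub (hsm n)).enorm.pow_const 2
  calc ∫⁻ x in ball (0 : Space N) k, ENNReal.ofReal (‖fn (w n) x‖ ^ 2)
      = ∫⁻ x in ball (0 : Space N) k, ‖fn (w n) x‖ₑ ^ 2 := by
        congr 1; ext x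
        rw [ENNReal.ofReal_pow (norm_nonneg _), ofReal_norm]
    _ ≤ ∫⁻ x in ball (0 : Space N) k, (2 * ‖fn (w n) x - ballAvg ε (fn (w n)) x‖ₑ ^ 2
          + 2 * ‖ballAvg ε (fn (w n)) x‖ₑ ^ 2) :=
        lintegral_mono fun x => enorm_sq_le_two_mul _ _
    _ = 2 * (∫⁻ x in ball (0 : Space N) k, ‖fn (w n) x - ballAvg ε (fn (w n)) x‖ₑ ^ 2)
          + 2 * ∫⁻ x in ball (0 : Space N) k, ‖ballAvg ε (fn (w n)) x‖ₑ ^ 2 := by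
        rw [lintegral_add_left (m1.const_mul 2), lintegral_const_mul' _ _ (by simp),
          lintegral_const_mul' _ _ (by simp)]
    _ ≤ 2 * ENNReal.ofReal (η / 4) + 2 * ENNReal.ofReal (η / 4) := by
        gcongr
        refine (setLIntegral_le_lintegral _ _).trans ((lintegral_sub_ballAvg_sq_le _ hε0).trans ?_)
        apply ENNReal.ofReal_le_ofReal
        have : ε * ‖grad (w n)‖ ≤ ε * R := by
          gcongr
          exact (norm_grad_le _).trans (hw n)
        calc (ε * ‖grad (w n)‖) ^ 2 ≤ (ε * R) ^ 2 := by gcongr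
          _ = η / 4 := by
            rw [hε, div_mul_cancel₀ _ hR.ne', Real.sq_sqrt (by positivity)]
    _ = ENNReal.ofReal η := by
        rw [← two_mul, ← mul_assoc, show (2 : ℝ≥0∞) * 2 = ENNReal.ofReal 4 by norm_num,
          ← ENNReal.ofReal_mul (by norm_num)]
        congr 1; ring

theorem tendsto_integral_cube_indicator (hN : N = 2 ∨ N = 3) (a : H1 N) :
    Tendsto (fun k : ℕ => ∫ x, Set.indicator {x | ‖x‖ < k ∧ ‖fn a x‖ ≤ k}ᶜ
      (fun x => ‖fn a x‖ ^ 3) x) atTop (𝓝 0) := by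
  have hm : Measurable fun x => ‖fn a x‖ := (Lp.stronglyMeasurable (fn a)).norm.measurable
  have hms (k : ℕ) : MeasurableSet {x | ‖x‖ < k ∧ ‖fn a x‖ ≤ k}ᶜ :=
    ((measurableSet_lt measurable_norm measurable_const).inter
      (measurableSet_le hm measurable_const)).compl
  have e0 : (0 : ℝ) = ∫ _ : Space N, (0 : ℝ) := by simp
  rw [e0]
  refine tendsto_integral_of_dominated_convergence (fun x => ‖fn a x‖ ^ 3) ?_
    (integrable_cube hN a) ?_ ?_
  · exact fun k => ((hm.pow_const 3).indicator (hms k)).aestronglyMeasurable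
  · refine fun k => Eventually.of_forall fun x => (norm_indicator_le_norm_self _ _).trans ?_
    rw [Real.norm_of_nonneg (by positivity)]
  · refine Eventually.of_forall fun x => tendsto_const_nhds.congr' ?_
    filter_upwards [tendsto_natCast_atTop_atTop.eventually_gt_atTop ‖x‖,
      tendsto_natCast_atTop_atTop.eventually_ge_atTop ‖fn a x‖] with k h1 h2
    simp [Set.indicator, h1, h2]

/-- The fixed factor a is split. On the part of the ball of radius k where |a| ≤ k, local
compactness applies; the rest of a is small in L³ and is handled by |a||w|² ≤ |a|³/τ² + τ|w|³.
Choosing τ, then k, then n makes each of the three contributions at most η/4. -/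
theorem tendsto_absTriple_zero (hN : N = 2 ∨ N = 3) {w : ℕ → H1 N} {R : ℝ}
    (hw : ∀ n, ‖w n‖ ≤ R) (h : WeakTendsto (fun n => fn (w n)) 0) (a : H1 N) :
    Tendsto (fun n => absTriple a (w n) (w n)) atTop (𝓝 0) := by
  wlog hR : 0 < R generalizing R
  · exact this (R := R + 1 + |R|) (fun n => by linarith [hw n, abs_nonneg R])
      (by linarith [neg_abs_le R])
  obtain ⟨C, hC, hcube⟩ := exists_integral_cube_le hN
  rw [Metric.tendsto_atTop']
  suffices hs : ∀ η > 0, ∀ᶠ n in atTop, absTriple a (w n) (w n) < η by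
    intro η hη
    obtain ⟨n₀, hn₀⟩ := eventually_atTop.1 (hs η hη)
    refine ⟨n₀, fun n hn => ?_⟩
    rw [Real.dist_eq, sub_zero, abs_of_nonneg (absTriple_nonneg _ _ _)]
    exact hn₀ n hn.le
  intro η hη
  set τ : ℝ := η / (4 * (C * R ^ 3)) with hτ
  have hτ0 : 0 < τ := by positivity
  have hκ : 0 < η / 4 * τ ^ 2 := by positivity
  obtain ⟨k, hk⟩ := ((tendsto_integral_cube_indicator hN a).eventually
    (gt_mem_nhds hκ)).exists
  have hk1 : 0 < η / (4 * (k + 1)) := by positivity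
  filter_upwards [tendsto_setIntegral_ball_sq hR hw h k hk1] with n hn
  set f := fn (w n)
  set Ek : Set (Space N) := {x | ‖x‖ < k ∧ ‖fn a x‖ ≤ k} with hEk
  have hm : Measurable fun x => ‖fn a x‖ := (Lp.stronglyMeasurable (fn a)).norm.measurable
  have hms : MeasurableSet Ekᶜ :=
    ((measurableSet_lt measurable_norm measurable_const).inter
      (measurableSet_le hm measurable_const)).compl
  have i1 : Integrable (fun x => k * (ball (0 : Space N) k).indicator (fun x => ‖f x‖ ^ 2) x)
      volume :=
    (((Lp.memLp f).integrable_norm_pow (by simp)).indicator measurableSet_ball).const_mul _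
  have i2 : Integrable (fun x => (τ ^ 2)⁻¹ * Ekᶜ.indicator (fun x => ‖fn a x‖ ^ 3) x) volume :=
    ((integrable_cube hN a).indicator hms).const_mul _
  have i3 : Integrable (fun x => τ * ‖f x‖ ^ 3) volume := (integrable_cube hN (w n)).const_mul _
  have pw : ∀ x, ‖fn a x‖ * ‖f x‖ * ‖f x‖
      ≤ k * (ball (0 : Space N) k).indicator (fun x => ‖f x‖ ^ 2) x
        + (τ ^ 2)⁻¹ * Ekᶜ.indicator (fun x => ‖fn a x‖ ^ 3) x + τ * ‖f x‖ ^ 3 := by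
    intro x
    have p3 : 0 ≤ τ * ‖f x‖ ^ 3 := by positivity
    by_cases hx : x ∈ Ek
    · have hb : x ∈ ball (0 : Space N) k := by simpa using hx.1
      rw [Set.indicator_of_mem hb, Set.indicator_of_notMem (by simpa using hx)]
      have : ‖fn a x‖ * ‖f x‖ * ‖f x‖ ≤ k * ‖f x‖ * ‖f x‖ := by
        gcongr; exact hx.2
      nlinarith
    · rw [Set.indicator_of_mem (show x ∈ Ekᶜ from hx)]
      have p1 : 0 ≤ (k : ℝ) * (ball (0 : Space N) k).indicator (fun x => ‖f x‖ ^ 2) x :=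
        mul_nonneg (by positivity) (Set.indicator_nonneg (fun x _ => by positivity) x)
      have key : ‖fn a x‖ / τ * ‖f x‖ * ‖f x‖ ≤ (‖fn a x‖ / τ) ^ 3 + ‖f x‖ ^ 3 := by
        have ha : 0 ≤ ‖fn a x‖ / τ := by positivity
        have hf := norm_nonneg (f x)
        rcases le_total (‖fn a x‖ / τ) ‖f x‖ with hle | hle
        · have : ‖fn a x‖ / τ * (‖f x‖ * ‖f x‖) ≤ ‖f x‖ * (‖f x‖ * ‖f x‖) := by gcongr
          nlinarith [pow_nonneg ha 3]
        · have : ‖fn a x‖ / τ * ‖f x‖ * ‖f x‖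
              ≤ ‖fn a x‖ / τ * (‖fn a x‖ / τ) * (‖fn a x‖ / τ) := by gcongr
          nlinarith [pow_nonneg hf 3]
      have e1 : ‖fn a x‖ * ‖f x‖ * ‖f x‖ = τ * (‖fn a x‖ / τ * ‖f x‖ * ‖f x‖) := by
        field_simp
      have e2 : τ * ((‖fn a x‖ / τ) ^ 3 + ‖f x‖ ^ 3)
          = (τ ^ 2)⁻¹ * ‖fn a x‖ ^ 3 + τ * ‖f x‖ ^ 3 := by
        field_simp
      have := mul_le_mul_of_nonneg_left key hτ0.le
      linarith
  have hint : absTriple a (w n) (w n) ≤ k * (∫ x in ball (0 : Space N) k, ‖f x‖ ^ 2)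
      + (τ ^ 2)⁻¹ * (∫ x, Ekᶜ.indicator (fun x => ‖fn a x‖ ^ 3) x) + τ * ∫ x, ‖f x‖ ^ 3 := by
    rw [← integral_indicator measurableSet_ball, ← integral_const_mul, ← integral_const_mul,
      ← integral_const_mul]
    refine (integral_mono (integrable_norm_triple hN a (w n) (w n)) ((i1.add i2).add i3)
      pw).trans (le_of_eq ?_)
    rw [← integral_add i1 i2]
    exact integral_add (i1.add i2) i3
  have b1 : k * (∫ x in ball (0 : Space N) k, ‖f x‖ ^ 2) ≤ η / 4 := by
    have : (k : ℝ) * (∫ x in ball (0 : Space N) k, ‖f x‖ ^ 2) ≤ k * (η / (4 * (k + 1))) := by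
      gcongr
    refine this.trans ?_
    rw [mul_div_assoc', div_le_div_iff₀ (by positivity) (by norm_num)]
    nlinarith
  have b2 : (τ ^ 2)⁻¹ * (∫ x, Ekᶜ.indicator (fun x => ‖fn a x‖ ^ 3) x) ≤ η / 4 := by
    rw [inv_mul_le_iff₀ (by positivity), mul_comm (τ ^ 2)]
    exact hk.le
  have b3 : τ * ∫ x, ‖f x‖ ^ 3 ≤ η / 4 := by
    have h3 : ∫ x, ‖f x‖ ^ 3 ≤ C * R ^ 3 := (hcube (w n)).trans (by
      have := hw n
      gcongr)
    calc τ * ∫ x, ‖f x‖ ^ 3 ≤ τ * (C * R ^ 3) := by gcongr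
      _ = η / 4 := by rw [hτ]; field_simp
  linarith

/-! ### The quadratic form and the splitting along weak null sequences. -/

/-- The quadratic form `c₁‖u₁‖² + c₂‖u₂‖² + (‖∇u₁‖² + ‖∇u₂‖²)/2`. -/
def quad (c₁ c₂ : ℝ) (u : H1Pair N) : ℝ :=
  c₁ * ‖fn u.1‖ ^ 2 + c₂ * ‖fn u.2‖ ^ 2 + 1 / 2 * (‖grad u.1‖ ^ 2 + ‖grad u.2‖ ^ 2)

/-- The first variation of `quad`. -/
def quadVar (c₁ c₂ : ℝ) (u h : H1Pair N) : ℝ :=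
  2 * c₁ * (inner ℂ (fn u.1) (fn h.1) : ℂ).re + 2 * c₂ * (inner ℂ (fn u.2) (fn h.2) : ℂ).re
    + ((inner ℂ (grad u.1) (grad h.1) : ℂ).re + (inner ℂ (grad u.2) (grad h.2) : ℂ).re)

theorem norm_add_sq_complex {F : Type*} [NormedAddCommGroup F] [InnerProductSpace ℂ F] (x y : F) :
    ‖x + y‖ ^ 2 = ‖x‖ ^ 2 + 2 * (inner ℂ x y : ℂ).re + ‖y‖ ^ 2 :=
  norm_add_sq (𝕜 := ℂ) x y

theorem quad_add (c₁ c₂ : ℝ) (u h : H1Pair N) :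
    quad c₁ c₂ (u + h) = quad c₁ c₂ u + quadVar c₁ c₂ u h + quad c₁ c₂ h := by
  simp only [quad, quadVar, Prod.fst_add, Prod.snd_add, fn_add, grad_add, norm_add_sq_complex]
  ring

theorem quad_smul (c₁ c₂ s : ℝ) (u : H1Pair N) : quad c₁ c₂ (s • u) = s ^ 2 * quad c₁ c₂ u := by
  simp only [quad, Prod.smul_fst, Prod.smul_snd, fn_real_smul, grad_real_smul, norm_smul,
    Complex.norm_real, Real.norm_eq_abs, mul_pow, sq_abs]
  ring

theorem quadVar_smul (c₁ c₂ s : ℝ) (u h : H1Pair N) :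
    quadVar c₁ c₂ u (s • h) = s * quadVar c₁ c₂ u h := by
  simp only [quadVar, Prod.smul_fst, Prod.smul_snd, fn_real_smul, grad_real_smul,
    inner_smul_right, Complex.re_ofReal_mul]
  ring

theorem quad_nonneg {c₁ c₂ : ℝ} (h₁ : 0 < c₁) (h₂ : 0 < c₂) (u : H1Pair N) :
    0 ≤ quad c₁ c₂ u := by
  unfold quad; positivity

theorem quad_le (c₁ c₂ : ℝ) (u : H1Pair N) :
    quad c₁ c₂ u ≤ (|c₁| + |c₂| + 1) * (‖u.1‖ ^ 2 + ‖u.2‖ ^ 2) := by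
  rw [H1.norm_sq_eq, H1.norm_sq_eq, quad]
  have h1 := le_abs_self c₁
  have h2 := le_abs_self c₂
  nlinarith [sq_nonneg ‖fn u.1‖, sq_nonneg ‖fn u.2‖, sq_nonneg ‖grad u.1‖, sq_nonneg ‖grad u.2‖,
    mul_nonneg (abs_nonneg c₁) (sq_nonneg ‖fn u.1‖), mul_nonneg (abs_nonneg c₁) (sq_nonneg ‖fn u.2‖),
    mul_nonneg (abs_nonneg c₂) (sq_nonneg ‖fn u.1‖), mul_nonneg (abs_nonneg c₂) (sq_nonneg ‖fn u.2‖),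
    mul_nonneg (abs_nonneg c₁) (sq_nonneg ‖grad u.1‖),
    mul_nonneg (abs_nonneg c₁) (sq_nonneg ‖grad u.2‖),
    mul_nonneg (abs_nonneg c₂) (sq_nonneg ‖grad u.1‖),
    mul_nonneg (abs_nonneg c₂) (sq_nonneg ‖grad u.2‖),
    mul_le_mul_of_nonneg_right h1 (sq_nonneg ‖fn u.1‖),
    mul_le_mul_of_nonneg_right h2 (sq_nonneg ‖fn u.2‖)]

theorem exists_le_quad {c₁ c₂ : ℝ} (h₁ : 0 < c₁) (h₂ : 0 < c₂) : ∃ c : ℝ, 0 < c ∧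
    ∀ u : H1Pair N, c * (‖u.1‖ ^ 2 + ‖u.2‖ ^ 2) ≤ quad c₁ c₂ u := by
  refine ⟨min (min c₁ c₂) (1 / 2), by positivity, fun u => ?_⟩
  rw [H1.norm_sq_eq, H1.norm_sq_eq, quad]
  set c := min (min c₁ c₂) (1 / 2)
  have e1 : c ≤ c₁ := (min_le_left _ _).trans (min_le_left _ _)
  have e2 : c ≤ c₂ := (min_le_left _ _).trans (min_le_right _ _)
  have e3 : c ≤ 1 / 2 := min_le_right _ _
  have p1 := mul_le_mul_of_nonneg_right e1 (sq_nonneg ‖fn u.1‖)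
  have p2 := mul_le_mul_of_nonneg_right e2 (sq_nonneg ‖fn u.2‖)
  have p3 := mul_le_mul_of_nonneg_right e3 (sq_nonneg ‖grad u.1‖)
  have p4 := mul_le_mul_of_nonneg_right e3 (sq_nonneg ‖grad u.2‖)
  linarith

theorem exists_norm_le_of_quad_le {c₁ c₂ : ℝ} (h₁ : 0 < c₁) (h₂ : 0 < c₂) (B : ℝ) :
    ∃ R : ℝ, 0 < R ∧ ∀ u : H1Pair N, quad c₁ c₂ u ≤ B → ‖u.1‖ ≤ R ∧ ‖u.2‖ ≤ R := by
  obtain ⟨c, hc, h⟩ := exists_le_quad (N := N) h₁ h₂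
  refine ⟨√(|B| / c) + 1, by positivity, fun u hu => ?_⟩
  have h1 : c * (‖u.1‖ ^ 2 + ‖u.2‖ ^ 2) ≤ |B| := (h u).trans (hu.trans (le_abs_self B))
  have h2 : ‖u.1‖ ^ 2 + ‖u.2‖ ^ 2 ≤ |B| / c := by
    rw [le_div_iff₀ hc]; linarith
  constructor
  · have : ‖u.1‖ ≤ √(|B| / c) := Real.le_sqrt_of_sq_le (by nlinarith [sq_nonneg ‖u.2‖])
    linarith
  · have : ‖u.2‖ ≤ √(|B| / c) := Real.le_sqrt_of_sq_le (by nlinarith [sq_nonneg ‖u.1‖])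
    linarith

theorem quad_pos {c₁ c₂ : ℝ} (h₁ : 0 < c₁) (h₂ : 0 < c₂) {u : H1Pair N} (hu : u ≠ 0) :
    0 < quad c₁ c₂ u := by
  obtain ⟨c, hc, h⟩ := exists_le_quad (N := N) h₁ h₂
  refine lt_of_lt_of_le (mul_pos hc ?_) (h u)
  by_contra hn
  apply hu
  have e1 : ‖u.1‖ = 0 := by nlinarith [sq_nonneg ‖u.1‖, sq_nonneg ‖u.2‖]
  have e2 : ‖u.2‖ = 0 := by nlinarith [sq_nonneg ‖u.1‖, sq_nonneg ‖u.2‖]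
  exact Prod.ext (norm_eq_zero.1 e1) (norm_eq_zero.1 e2)

theorem abs_G_le (u : H1Pair N) : |G u| ≤ absTriple u.1 u.1 u.2 := by
  rw [G_eq_triple]; exact abs_triple_le _ _ _

theorem G_zero : G (0 : H1Pair N) = 0 := by
  have := G_smul 0 (0 : H1Pair N)
  simpa using this

/-- Integrate |a| τ (|c| - |b|/τ)² ≥ 0. Mixed products are thus controlled by squares, which lets
the vanishing of `absTriple a w w` pass to terms containing w only once. -/
theorem two_mul_absTriple_le (hN : N = 2 ∨ N = 3) (a b c : H1 N) {τ : ℝ} (hτ : 0 < τ) :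
    2 * absTriple a b c ≤ τ * absTriple a c c + τ⁻¹ * absTriple a b b := by
  unfold absTriple
  rw [← integral_const_mul, ← integral_const_mul, ← integral_const_mul,
    ← integral_add ((integrable_norm_triple hN a c c).const_mul _)
      ((integrable_norm_triple hN a b b).const_mul _)]
  refine integral_mono ((integrable_norm_triple hN a b c).const_mul _)
    (((integrable_norm_triple hN a c c).const_mul _).add
      ((integrable_norm_triple hN a b b).const_mul _)) fun x => ?_
  have hp : 0 ≤ ‖fn a x‖ * (τ * (‖fn c x‖ - τ⁻¹ * ‖fn b x‖) ^ 2) := by positivity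
  have e : ‖fn a x‖ * (τ * (‖fn c x‖ - τ⁻¹ * ‖fn b x‖) ^ 2)
      = τ * (‖fn a x‖ * ‖fn c x‖ * ‖fn c x‖) + τ⁻¹ * (‖fn a x‖ * ‖fn b x‖ * ‖fn b x‖)
        - 2 * (‖fn a x‖ * ‖fn b x‖ * ‖fn c x‖) := by
    field_simp
    ring
  show 2 * (‖fn a x‖ * ‖fn b x‖ * ‖fn c x‖) ≤ τ * (‖fn a x‖ * ‖fn c x‖ * ‖fn c x‖)
    + τ⁻¹ * (‖fn a x‖ * ‖fn b x‖ * ‖fn b x‖)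
  linarith

theorem tendsto_absTriple_mid_zero (hN : N = 2 ∨ N = 3) {w : ℕ → H1 N} {R : ℝ}
    (hw : ∀ n, ‖w n‖ ≤ R) (h : WeakTendsto (fun n => fn (w n)) 0) (a b : H1 N) :
    Tendsto (fun n => absTriple a (w n) b) atTop (𝓝 0) := by
  have h0 := tendsto_absTriple_zero hN hw h a
  have hb := absTriple_nonneg a b b
  rw [Metric.tendsto_atTop'] at *
  intro η hη
  set τ : ℝ := η / (absTriple a b b + 1)
  have hτ : 0 < τ := by positivity
  obtain ⟨n₀, hn₀⟩ := h0 (η * τ) (by positivity)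
  refine ⟨n₀, fun n hn => ?_⟩
  have h1 := hn₀ n hn
  rw [Real.dist_eq, sub_zero, abs_of_nonneg (absTriple_nonneg _ _ _)] at *
  have h2 := two_mul_absTriple_le hN a (w n) b hτ
  have h3 : τ⁻¹ * absTriple a (w n) (w n) < η := by
    rw [inv_mul_lt_iff₀ hτ]; linarith
  have h4 : τ * absTriple a b b ≤ η := by
    simp only [τ]
    rw [div_mul_eq_mul_div, div_le_iff₀ (by positivity)]
    nlinarith
  linarith

/-- Weak null sequences split the cubic functional. -/
theorem tendsto_G_split (hN : N = 2 ∨ N = 3) {w : ℕ → H1Pair N} {R : ℝ}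
    (h₁ : ∀ n, ‖(w n).1‖ ≤ R) (h₂ : ∀ n, ‖(w n).2‖ ≤ R)
    (w₁ : WeakTendsto (fun n => fn (w n).1) 0) (w₂ : WeakTendsto (fun n => fn (w n).2) 0)
    (v : H1Pair N) : Tendsto (fun n => G (v + w n) - G v - G (w n)) atTop (𝓝 0) := by
  have t1 := tendsto_absTriple_mid_zero hN h₁ w₁ v.1 v.2
  have t2 := tendsto_absTriple_mid_zero hN h₂ w₂ v.1 v.1
  have t3 := tendsto_absTriple_zero hN h₁ w₁ v.2
  have t4 := tendsto_absTriple_zero hN h₁ w₁ v.1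
  have t5 := tendsto_absTriple_zero hN h₂ w₂ v.1
  have tt := (((t1.const_mul 2).add t2).add t3).add (t4.add t5)
  simp only [mul_zero, add_zero] at tt
  refine squeeze_zero_norm (fun n => ?_) tt
  rw [G_add hN, Real.norm_eq_abs]
  have a1 := abs_le.1 (abs_triple_le v.1 (w n).1 v.2)
  have a2 := abs_le.1 (abs_triple_le v.1 v.1 (w n).2)
  have a3 := abs_le.1 (abs_triple_le (w n).1 (w n).1 v.2)
  have a4 := abs_le.1 (abs_triple_le v.1 (w n).1 (w n).2)
  rw [absTriple_comm v.1 v.1] at a2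
  rw [absTriple_comm (w n).1, absTriple_swap (w n).1] at a3
  have a5 := two_mul_absTriple_le hN v.1 (w n).1 (w n).2 one_pos
  rw [abs_le]
  constructor <;> linarith [a1.1, a1.2, a2.1, a2.2, a3.1, a3.2, a4.1, a4.2]

theorem tendsto_quad_split (c₁ c₂ : ℝ) {w : ℕ → H1Pair N}
    (w₁ : WeakTendsto (fun n => fn (w n).1) 0) (w₂ : WeakTendsto (fun n => fn (w n).2) 0)
    (g₁ : WeakTendsto (fun n => grad (w n).1) 0) (g₂ : WeakTendsto (fun n => grad (w n).2) 0)
    (v : H1Pair N) :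
    Tendsto (fun n => quad c₁ c₂ (v + w n) - quad c₁ c₂ v - quad c₁ c₂ (w n)) atTop (𝓝 0) := by
  have re {F : Type} [NormedAddCommGroup F] [InnerProductSpace ℂ F] {x : ℕ → F}
      (h : WeakTendsto x 0) (z : F) : Tendsto (fun n => (inner ℂ z (x n) : ℂ).re) atTop (𝓝 0) := by
    have := (Complex.continuous_re.tendsto _).comp (h z)
    rw [inner_zero_right, Complex.zero_re] at this
    exact this
  have tt := (((re w₁ (fn v.1)).const_mul (2 * c₁)).add ((re w₂ (fn v.2)).const_mul (2 * c₂))).add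
    ((re g₁ (grad v.1)).add (re g₂ (grad v.2)))
  simp only [mul_zero, add_zero] at tt
  refine tt.congr fun n => ?_
  rw [quad_add, quadVar]
  ring

/-! ### Existence of a maximizer of G at fixed `quad`. -/

/-- Nonvanishing: a lower bound for `G` yields a lower bound for an average over some ball. -/
theorem exists_lt_ballAvg (hN : N = 2 ∨ N = 3) {R g : ℝ} (hR : 0 < R) (hg : 0 < g) :
    ∃ ε δ : ℝ, 0 < ε ∧ 0 < δ ∧ ∀ u : H1Pair N, ‖u.1‖ ≤ R → ‖u.2‖ ≤ R → g ≤ G u →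
      ∃ x, δ < ‖ballAvg ε (fn u.1) x‖ + ‖ballAvg ε (fn u.2) x‖ := by
  -- If all averages were small, three cubic integrals of size g/4 would bound G by 3g/4 < g.
  obtain ⟨ε, δ, hε, hδ, h⟩ := exists_forall_ballAvg_le_imp hN hR (show 0 < g / 4 by positivity)
  refine ⟨ε, δ, hε, hδ, fun u h₁ h₂ hG => ?_⟩
  by_contra! hn
  have k1 := h u.1 h₁ fun x => by linarith [hn x, norm_nonneg (ballAvg ε (fn u.2) x)]
  have k2 := h u.2 h₂ fun x => by linarith [hn x, norm_nonneg (ballAvg ε (fn u.1) x)]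
  have := absTriple_le_cubes hN u.1 u.1 u.2
  linarith [le_abs_self (G u), abs_G_le u]

/-- Moves a ball on which some average is large to the origin, where the average survives in the
weak limit. -/
theorem exists_translate (c₁ c₂ : ℝ) (u : H1Pair N) (ε : ℝ) (y : Space N) : ∃ w : H1Pair N,
    quad c₁ c₂ w = quad c₁ c₂ u ∧ G w = G u ∧ ballAvg ε (fn w.1) 0 = ballAvg ε (fn u.1) y ∧
      ballAvg ε (fn w.2) 0 = ballAvg ε (fn u.2) y := by
  obtain ⟨w, e₁, e₂, f₁, f₂, g₁, g₂, hG⟩ := exists_affine_pair u one_pos y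
  have key (f : Space N → ℂ) : ballAvg ε (fun x => f ((1 : ℝ) • x + y)) 0 = ballAvg ε f y := by
    simp [ballAvg, add_comm]
  refine ⟨w, ?_, by simpa using hG, ?_, ?_⟩
  · rw [quad, f₁, f₂, g₁, g₂, quad]; simp
  · rw [ballAvg_congr e₁, key]
  · rw [ballAvg_congr e₂, key]

theorem exists_subseq_weakTendsto_pair {u : ℕ → H1Pair N} {R : ℝ} (h₁ : ∀ n, ‖(u n).1‖ ≤ R)
    (h₂ : ∀ n, ‖(u n).2‖ ≤ R) : ∃ v : H1Pair N, ∃ φ : ℕ → ℕ, StrictMono φ ∧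
      WeakTendsto (fun n => fn (u (φ n)).1) (fn v.1) ∧
      WeakTendsto (fun n => fn (u (φ n)).2) (fn v.2) ∧
      WeakTendsto (fun n => grad (u (φ n)).1) (grad v.1) ∧
      WeakTendsto (fun n => grad (u (φ n)).2) (grad v.2) := by
  obtain ⟨v₁, φ, hφ, f₁, g₁⟩ := exists_subseq_weakTendsto_H1 h₁
  obtain ⟨v₂, ψ, hψ, f₂, g₂⟩ := exists_subseq_weakTendsto_H1 (u := fun n => (u (φ n)).2)
    fun n => h₂ (φ n)
  exact ⟨(v₁, v₂), φ ∘ ψ, hφ.comp hψ, f₁.subseq hψ, f₂, g₁.subseq hψ, g₂⟩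

theorem exists_G_le_of_quad_eq_one (hN : N = 2 ∨ N = 3) {c₁ c₂ : ℝ} (h₁ : 0 < c₁) (h₂ : 0 < c₂) :
    ∃ B : ℝ, ∀ u : H1Pair N, quad c₁ c₂ u = 1 → G u ≤ B := by
  obtain ⟨C, hC, hT⟩ := exists_absTriple_le hN
  obtain ⟨R, hR, h⟩ := exists_norm_le_of_quad_le (N := N) h₁ h₂ 1
  refine ⟨C * R * R * R, fun u hu => ?_⟩
  obtain ⟨k1, k2⟩ := h u hu.le
  refine (le_abs_self _).trans ((abs_G_le u).trans ((hT _ _ _).trans ?_))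
  gcongr

theorem G_le_mul_sqrt_quad_cube {c₁ c₂ : ℝ} (h₁ : 0 < c₁) (h₂ : 0 < c₂) {S : ℝ}
    (hS : ∀ u : H1Pair N, quad c₁ c₂ u = 1 → G u ≤ S) (w : H1Pair N) :
    G w ≤ S * √(quad c₁ c₂ w) ^ 3 := by
  rcases eq_or_ne w 0 with rfl | hw
  · have : quad c₁ c₂ (0 : H1Pair N) = 0 := by simpa using quad_smul c₁ c₂ 0 (0 : H1Pair N)
    rw [G_zero, this]; simp
  · have hq := quad_pos h₁ h₂ hw
    set q := √(quad c₁ c₂ w) with hqd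
    have hq0 : 0 < q := Real.sqrt_pos.2 hq
    have hsq : q ^ 2 = quad c₁ c₂ w := Real.sq_sqrt hq.le
    have := hS (q⁻¹ • w) (by rw [quad_smul, ← hsq]; field_simp)
    rw [G_smul, inv_pow, inv_mul_le_iff₀ (by positivity)] at this
    linarith

/-- If 0 < x, y < 1 and x² + y² = 1, then x³ + y³ < 1. Hence `quad` cannot be shared between the
weak limit (a) and the remainder (1 - a) without G dropping strictly below S. -/
theorem eq_one_of_cube_sqrt_le {S a g : ℝ} (hS : 0 < S) (ha0 : 0 < a) (ha1 : 0 ≤ 1 - a)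
    (h1 : S - g ≤ S * √(1 - a) ^ 3) (h2 : g ≤ S * √a ^ 3) : a = 1 := by
  by_contra hne
  have hlt : a < 1 := lt_of_le_of_ne (by linarith) hne
  set x := √a with hx
  set y := √(1 - a) with hy
  have hx0 : 0 < x := Real.sqrt_pos.2 ha0
  have hy0 : 0 < y := Real.sqrt_pos.2 (by linarith)
  have hx2 : x ^ 2 = a := Real.sq_sqrt ha0.le
  have hy2 : y ^ 2 = 1 - a := Real.sq_sqrt ha1
  have hx1 : x < 1 := by nlinarith
  have hy1 : y < 1 := by nlinarith
  have : x ^ 3 + y ^ 3 < 1 := by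
    have e1 : x ^ 3 < x ^ 2 := by nlinarith [pow_pos hx0 2]
    have e2 : y ^ 3 < y ^ 2 := by nlinarith [pow_pos hy0 2]
    linarith
  nlinarith

/-- The slack S/(n+2) never exceeds S/2, so nonvanishing at level S/2 applies to every member of the
sequence, including n = 0. -/
theorem exists_nearly_maximal {c₁ c₂ ε δ R S : ℝ} (hS0 : 0 < S)
    (hne : (G '' {u : H1Pair N | quad c₁ c₂ u = 1}).Nonempty)
    (hav : ∀ u : H1Pair N, ‖u.1‖ ≤ R → ‖u.2‖ ≤ R →
      sSup (G '' {u : H1Pair N | quad c₁ c₂ u = 1}) / 2 ≤ G u →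
      ∃ x, δ < ‖ballAvg ε (fn u.1) x‖ + ‖ballAvg ε (fn u.2) x‖)
    (hnorm : ∀ u : H1Pair N, quad c₁ c₂ u ≤ 1 → ‖u.1‖ ≤ R ∧ ‖u.2‖ ≤ R)
    (hSdef : S = sSup (G '' {u : H1Pair N | quad c₁ c₂ u = 1})) (n : ℕ) :
    ∃ u : H1Pair N, quad c₁ c₂ u = 1 ∧ S - S / (n + 2) < G u ∧
      δ < ‖ballAvg ε (fn u.1) 0‖ + ‖ballAvg ε (fn u.2) 0‖ := by
  rw [← hSdef] at hav
  have hlt : S - S / (n + 2) < S := by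
    have : 0 < S / ((n : ℝ) + 2) := by positivity
    linarith
  obtain ⟨_, ⟨u, hu, rfl⟩, hGu⟩ := exists_lt_of_lt_csSup hne (hlt.trans_eq hSdef)
  have hhalf : S / 2 ≤ G u := by
    have : S / ((n : ℝ) + 2) ≤ S / 2 := by
      gcongr; linarith [(Nat.cast_nonneg n : (0 : ℝ) ≤ n)]
    linarith
  obtain ⟨k1, k2⟩ := hnorm u (le_of_eq hu)
  obtain ⟨y, hy⟩ := hav u k1 k2 hhalf
  obtain ⟨w, q1, q2, q3, q4⟩ := exists_translate c₁ c₂ u ε y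
  exact ⟨w, q1.trans hu, by rwa [q2], by rwa [q3, q4]⟩

set_option maxHeartbeats 800000 in
/-- The supremum of `G` on `{quad = 1}` is attained. -/
theorem exists_maximizer (hN : N = 2 ∨ N = 3) {c₁ c₂ : ℝ} (h₁ : 0 < c₁) (h₂ : 0 < c₂)
    {u₀ : H1Pair N} (hu₀ : 0 < G u₀) : ∃ v : H1Pair N, 0 < G v ∧ 0 < quad c₁ c₂ v ∧
      ∀ w : H1Pair N, G w ^ 2 * quad c₁ c₂ v ^ 3 ≤ G v ^ 2 * quad c₁ c₂ w ^ 3 := by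
  let V : Set ℝ := G '' {u : H1Pair N | quad c₁ c₂ u = 1}
  have hbdd : BddAbove V := by
    obtain ⟨B, hB⟩ := exists_G_le_of_quad_eq_one hN h₁ h₂
    refine ⟨B, ?_⟩
    rintro _ ⟨u, hu, rfl⟩
    exact hB u hu
  let S := sSup V
  have hS : ∀ u : H1Pair N, quad c₁ c₂ u = 1 → G u ≤ S := fun u hu => le_csSup hbdd ⟨u, hu, rfl⟩
  have hbound := G_le_mul_sqrt_quad_cube h₁ h₂ hS
  have hu0 : u₀ ≠ 0 := by rintro rfl; rw [G_zero] at hu₀; exact lt_irrefl _ hu₀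
  have hq0 := quad_pos h₁ h₂ hu0
  have hS0 : 0 < S := by
    have := hbound u₀
    by_contra hn
    have : 0 < √(quad c₁ c₂ u₀) ^ 3 := by positivity
    nlinarith
  have hVne : V.Nonempty := by
    refine ⟨_, (√(quad c₁ c₂ u₀))⁻¹ • u₀, ?_, rfl⟩
    rw [Set.mem_ofPred_eq, quad_smul, inv_pow, Real.sq_sqrt hq0.le, inv_mul_cancel₀ hq0.ne']
  obtain ⟨R, hR, hnorm⟩ := exists_norm_le_of_quad_le (N := N) h₁ h₂ 1
  obtain ⟨ε, δ, hε, hδ, hav⟩ := exists_lt_ballAvg hN hR (half_pos hS0)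
  have hseq := exists_nearly_maximal hS0 hVne hav hnorm rfl
  choose u hu1 hu2 hu3 using hseq
  obtain ⟨v, φ, hφ, f₁, f₂, g₁, g₂⟩ := exists_subseq_weakTendsto_pair
    (fun n => (hnorm (u n) (hu1 n).le).1) (fun n => (hnorm (u n) (hu1 n).le).2)
  -- The averages at the origin stay above δ and converge to those of v.
  have hv0 : v ≠ 0 := by
    rintro rfl
    have t := (f₁.ballAvg ε 0).norm.add (f₂.ballAvg ε 0).norm
    have z : ballAvg ε (fn (0 : H1 N)) 0 = 0 := by
      have e0 : fn (0 : H1 N) =ᵐ[volume] 0 := Lp.coeFn_zero _ _ _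
      rw [ballAvg_congr e0]
      simp [ballAvg]
    have : δ ≤ ‖ballAvg ε (fn (0 : H1Pair N).1) 0‖ + ‖ballAvg ε (fn (0 : H1Pair N).2) 0‖ :=
      ge_of_tendsto' t fun n => (hu3 (φ n)).le
    simp only [Prod.fst_zero, Prod.snd_zero, z, norm_zero, add_zero] at this
    linarith
  set w : ℕ → H1Pair N := fun n => u (φ n) - v with hw
  have hvw (n : ℕ) : v + w n = u (φ n) := by simp [hw]
  have F₁ : WeakTendsto (fun n => fn (w n).1) 0 := f₁.sub_const
  have F₂ : WeakTendsto (fun n => fn (w n).2) 0 := f₂.sub_const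
  have E₁ : WeakTendsto (fun n => grad (w n).1) 0 := g₁.sub_const
  have E₂ : WeakTendsto (fun n => grad (w n).2) 0 := g₂.sub_const
  have hw₁ : ∀ n, ‖(w n).1‖ ≤ R + ‖v.1‖ + ‖v.2‖ := fun n => by
    have := norm_sub_le (u (φ n)).1 v.1
    have := (hnorm _ (hu1 (φ n)).le).1
    have h' : (w n).1 = (u (φ n)).1 - v.1 := rfl
    rw [h']
    linarith [norm_nonneg v.2]
  have hw₂ : ∀ n, ‖(w n).2‖ ≤ R + ‖v.1‖ + ‖v.2‖ := fun n => by
    have := norm_sub_le (u (φ n)).2 v.2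
    have := (hnorm _ (hu1 (φ n)).le).2
    have h' : (w n).2 = (u (φ n)).2 - v.2 := rfl
    rw [h']
    linarith [norm_nonneg v.1]
  have tG := tendsto_G_split hN hw₁ hw₂ F₁ F₂ v
  have tQ := tendsto_quad_split c₁ c₂ F₁ F₂ E₁ E₂ v
  simp only [hvw] at tG tQ
  set a := quad c₁ c₂ v with ha
  have ha0 : 0 < a := quad_pos h₁ h₂ hv0
  have hQw : Tendsto (fun n => quad c₁ c₂ (w n)) atTop (𝓝 (1 - a)) := by
    have := (tendsto_const_nhds (x := 1 - a)).sub tQ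
    rw [sub_zero] at this
    refine this.congr fun n => ?_
    rw [hu1]; ring
  have hGu : Tendsto (fun n => G (u (φ n))) atTop (𝓝 S) := by
    have t1 : Tendsto (fun n : ℕ => S - S / ((n : ℝ) + 2)) atTop (𝓝 S) := by
      have := (tendsto_natCast_atTop_atTop (R := ℝ)).atTop_add (tendsto_const_nhds (x := (2 : ℝ)))
      have := (tendsto_const_nhds (x := S)).sub ((tendsto_const_nhds (x := S)).div_atTop this)
      simpa using this
    have t2 : Tendsto (fun n => G (u n)) atTop (𝓝 S) :=
      tendsto_of_tendsto_of_tendsto_of_le_of_le t1 tendsto_const_nhds (fun n => (hu2 n).le)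
        (fun n => hS _ (hu1 n))
    exact t2.comp hφ.tendsto_atTop
  have hGw : Tendsto (fun n => G (w n)) atTop (𝓝 (S - G v)) := by
    have := (hGu.sub_const (G v)).sub tG
    rw [sub_zero] at this
    exact this.congr fun n => by ring
  have ha1 : 0 ≤ 1 - a := ge_of_tendsto' hQw fun n => quad_nonneg h₁ h₂ _
  -- The homogeneous bound for the remainders passes to the limit; with the same bound for v it
  -- forces a = 1, hence G v ≥ S.
  have key1 : S - G v ≤ S * √(1 - a) ^ 3 :=
    le_of_tendsto_of_tendsto' hGw (((hQw.sqrt).pow 3).const_mul S) fun n => hbound (w n)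
  have key2 : G v ≤ S * √a ^ 3 := hbound v
  have ha_eq : a = 1 := eq_one_of_cube_sqrt_le hS0 ha0 ha1 key1 key2
  have hGv : S ≤ G v := by
    rw [ha_eq] at key1
    simp at key1
    exact key1
  refine ⟨v, hS0.trans_le hGv, ha0, fun z => ?_⟩
  rw [← ha, ha_eq, one_pow, mul_one]
  have hz := quad_nonneg h₁ h₂ z
  have b1 := hbound z
  -- G is odd, so the bound at -z turns the one-sided estimate into one for |G z|.
  have b2 := hbound ((-1 : ℝ) • z)
  rw [G_smul, quad_smul] at b2
  norm_num at b2
  have hs6 : (√(quad c₁ c₂ z) ^ 3) ^ 2 = quad c₁ c₂ z ^ 3 := by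
    rw [← pow_mul, mul_comm 3 2, pow_mul, Real.sq_sqrt hz]
  calc G z ^ 2 ≤ (S * √(quad c₁ c₂ z) ^ 3) ^ 2 := sq_le_sq' (by linarith) b1
    _ = S ^ 2 * quad c₁ c₂ z ^ 3 := by rw [mul_pow, hs6]
    _ ≤ G v ^ 2 * quad c₁ c₂ z ^ 3 := by gcongr

/-! ### The Euler–Lagrange equation and the variational characterization of ground states. -/

/-- The first variation of `G`. -/
def GVar (u h : H1Pair N) : ℝ := 2 * triple u.1 h.1 u.2 + triple u.1 u.1 h.2

/-- The second-order part of `G`. -/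
def GVarTwo (u h : H1Pair N) : ℝ := triple h.1 h.1 u.2 + 2 * triple u.1 h.1 h.2

theorem G_add_smul (hN : N = 2 ∨ N = 3) (u h : H1Pair N) (t : ℝ) :
    G (u + t • h) = G u + t * GVar u h + t ^ 2 * GVarTwo u h + t ^ 3 * G h := by
  have e1 : triple u.1 (t • h.1) u.2 = t * triple u.1 h.1 u.2 := by
    rw [triple_comm, triple_comm u.1]; exact triple_smul_left t h.1 u.1 u.2
  have e2 : triple u.1 u.1 (t • h.2) = t * triple u.1 u.1 h.2 := triple_smul_right t u.1 u.1 h.2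
  have e3 (p : H1 N) : triple (t • h.1) p u.2 = t * triple h.1 p u.2 :=
    triple_smul_left t h.1 p u.2
  have e4 : triple u.1 (t • h.1) (t • h.2) = t * (t * triple u.1 h.1 h.2) := by
    have k1 : triple u.1 (t • h.1) (t • h.2) = t * triple u.1 (t • h.1) h.2 :=
      triple_smul_right t u.1 (t • h.1) h.2
    have k2 : triple (t • h.1) u.1 h.2 = t * triple h.1 u.1 h.2 :=
      triple_smul_left t h.1 u.1 h.2
    rw [k1, triple_comm u.1, k2, triple_comm u.1]
  have e5 : triple (t • h.1) (t • h.1) u.2 = t * (t * triple h.1 h.1 u.2) := by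
    rw [e3, triple_comm, e3]
  have e6 : G (u + t • h) = G u + (2 * triple u.1 (t • h.1) u.2 + triple u.1 u.1 (t • h.2))
      + (triple (t • h.1) (t • h.1) u.2 + 2 * triple u.1 (t • h.1) (t • h.2)) + G (t • h) :=
    G_add hN u (t • h)
  have e7 : G (t • h) = t ^ 3 * G h := G_smul t h
  unfold GVar GVarTwo
  linear_combination e6 + e7 + 2 * e1 + e2 + e5 + 2 * e4

theorem Jom_eq (m₁ m₂ ω : ℝ) (u : H1Pair N) :
    Jom m₁ m₂ ω u = quad ((m₁ ^ 2 - ω ^ 2) / 2) ((m₂ ^ 2 - 4 * ω ^ 2) / 2) u - G u := by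
  simp only [Jom, Mom, L, quad]; ring

/-- At a maximizer of `G² / quad³` normalised by `2 quad = 3 G`, the first variation of
`quad - G` vanishes. -/
theorem quadVar_eq_GVar (hN : N = 2 ∨ N = 3) {c₁ c₂ : ℝ} {v : H1Pair N} (hG : 0 < G v)
    (hnorm : 2 * quad c₁ c₂ v = 3 * G v)
    (hmax : ∀ w : H1Pair N, G w ^ 2 * quad c₁ c₂ v ^ 3 ≤ G v ^ 2 * quad c₁ c₂ w ^ 3)
    (h : H1Pair N) : quadVar c₁ c₂ v h = GVar v h := by
  set g := G v
  set Q := quad c₁ c₂ v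
  -- The quotient inequality with denominators cleared is polynomial in t, nonnegative, and an
  -- equality at t = 0; hence p'(0) = 0.
  let p : ℝ → ℝ := fun t =>
    g ^ 2 * (Q + t * quadVar c₁ c₂ v h + t ^ 2 * quad c₁ c₂ h) ^ 3
      - (g + t * GVar v h + t ^ 2 * GVarTwo v h + t ^ 3 * G h) ^ 2 * Q ^ 3
  have hp : ∀ t, 0 ≤ p t := fun t => by
    have := hmax (v + t • h)
    rw [G_add_smul hN, quad_add, quadVar_smul, quad_smul] at this
    exact sub_nonneg.2 this
  have hp0 : p 0 = 0 := by simp [p]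
  have hmin : IsLocalMin p 0 := Eventually.of_forall fun t => by rw [hp0]; exact hp t
  have id0 := hasDerivAt_id (0 : ℝ)
  have e1 := ((((id0.mul_const (quadVar c₁ c₂ v h)).const_add Q).add
    ((id0.pow 2).mul_const (quad c₁ c₂ h))).pow 3).const_mul (g ^ 2)
  have e2 := (((((id0.mul_const (GVar v h)).const_add g).add
    ((id0.pow 2).mul_const (GVarTwo v h))).add
    ((id0.pow 3).mul_const (G h))).pow 2).mul_const (Q ^ 3)
  have hd : HasDerivAt p _ 0 := e1.sub e2
  have := hmin.hasDerivAt_eq_zero hd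
  simp at this
  have hQ : Q = 3 / 2 * g := by linarith
  rw [hQ] at this
  -- With Q = 3g/2 the derivative is (27/4) g⁴ (`quadVar` - `GVar`).
  have h3 : g ^ 4 * (quadVar c₁ c₂ v h - GVar v h) = 0 := by
    linear_combination (4 / 27) * this
  have := (mul_eq_zero.1 h3).resolve_left (by positivity)
  linarith

theorem exists_abs_remainder_le (hN : N = 2 ∨ N = 3) (c₁ c₂ : ℝ) (v : H1Pair N) :
    ∃ C : ℝ, 0 ≤ C ∧ ∀ h : H1Pair N, ‖h‖ ≤ 1 →
      |quad c₁ c₂ h| + |GVarTwo v h| + |G h| ≤ C * ‖h‖ ^ 2 := by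
  obtain ⟨C, hC, hT⟩ := exists_absTriple_le hN
  refine ⟨2 * (|c₁| + |c₂| + 1) + (C * ‖v.2‖ + 2 * (C * ‖v.1‖)) + C, by positivity, fun h hh => ?_⟩
  have k1 : ‖h.1‖ ≤ ‖h‖ := norm_fst_le h
  have k2 : ‖h.2‖ ≤ ‖h‖ := norm_snd_le h
  have hn := norm_nonneg h
  have hq : |quad c₁ c₂ h| ≤ 2 * (|c₁| + |c₂| + 1) * ‖h‖ ^ 2 := by
    have s1 : ‖h.1‖ ^ 2 + ‖h.2‖ ^ 2 ≤ 2 * ‖h‖ ^ 2 := by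
      have : ‖h.1‖ ^ 2 ≤ ‖h‖ ^ 2 := by gcongr
      have : ‖h.2‖ ^ 2 ≤ ‖h‖ ^ 2 := by gcongr
      linarith
    have u1 := quad_le c₁ c₂ h
    have u2 := quad_le (-c₁) (-c₂) h
    have u3 : -quad c₁ c₂ h ≤ quad (-c₁) (-c₂) h := by
      unfold quad; nlinarith [sq_nonneg ‖grad h.1‖, sq_nonneg ‖grad h.2‖]
    rw [abs_neg, abs_neg] at u2
    have u4 : (|c₁| + |c₂| + 1) * (‖h.1‖ ^ 2 + ‖h.2‖ ^ 2)
        ≤ (|c₁| + |c₂| + 1) * (2 * ‖h‖ ^ 2) := by gcongr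
    rw [abs_le]
    constructor <;> linarith
  have hg2 : |GVarTwo v h| ≤ (C * ‖v.2‖ + 2 * (C * ‖v.1‖)) * ‖h‖ ^ 2 := by
    have a1 : |triple h.1 h.1 v.2| ≤ C * ‖h‖ * ‖h‖ * ‖v.2‖ :=
      (abs_triple_le _ _ _).trans ((hT _ _ _).trans (by gcongr))
    have a2 : |triple v.1 h.1 h.2| ≤ C * ‖v.1‖ * ‖h‖ * ‖h‖ :=
      (abs_triple_le _ _ _).trans ((hT _ _ _).trans (by gcongr))
    calc |GVarTwo v h| ≤ |triple h.1 h.1 v.2| + |2 * triple v.1 h.1 h.2| := abs_add_le _ _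
      _ = |triple h.1 h.1 v.2| + 2 * |triple v.1 h.1 h.2| := by rw [abs_mul, abs_two]
      _ ≤ C * ‖h‖ * ‖h‖ * ‖v.2‖ + 2 * (C * ‖v.1‖ * ‖h‖ * ‖h‖) := by gcongr
      _ = _ := by ring
  have hg : |G h| ≤ C * ‖h‖ ^ 2 := by
    have a1 : |G h| ≤ C * ‖h‖ * ‖h‖ * 1 :=
      (abs_G_le _).trans ((hT _ _ _).trans (by gcongr; exact k2.trans hh))
    linarith
  linarith

theorem hasFDerivAt_zero_of_quadratic_bound {V : Type*} [NormedAddCommGroup V] [NormedSpace ℝ V]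
    {f : V → ℝ} {v : V} {C : ℝ} (h : ∀ x : V, ‖x‖ ≤ 1 → |f (v + x) - f v| ≤ C * ‖x‖ ^ 2) :
    HasFDerivAt f (0 : V →L[ℝ] ℝ) v := by
  rw [hasFDerivAt_iff_isLittleO_nhds_zero]
  refine Asymptotics.IsBigO.trans_isLittleO (g := fun x : V => ‖x‖ ^ 2) ?_
    (Asymptotics.isLittleO_norm_pow_id one_lt_two)
  refine Asymptotics.IsBigO.of_bound C ?_
  filter_upwards [Metric.closedBall_mem_nhds (0 : V) one_pos] with x hx
  simpa using h x (mem_closedBall_zero_iff.1 hx)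

theorem hasDerivAt_ray_of_hasFDerivAt_zero {V : Type*} [NormedAddCommGroup V] [NormedSpace ℝ V]
    {f : V → ℝ} {v : V} (h : HasFDerivAt f (0 : V →L[ℝ] ℝ) v) :
    HasDerivAt (fun s : ℝ => f (s • v)) 0 1 := by
  have hs : HasDerivAt (fun s : ℝ => s • v) v 1 := by
    simpa using (hasDerivAt_id (1 : ℝ)).smul_const v
  have h' : HasFDerivAt f (0 : V →L[ℝ] ℝ) ((1 : ℝ) • v) := by
    rwa [one_smul]
  exact h'.comp_hasDerivAt (1 : ℝ) hs

/-- Passes from vanishing directional variations to Fréchet criticality: once the linear terms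
cancel, the increment of the action is quadratically small in h. -/
theorem hasFDerivAt_Jom_zero (hN : N = 2 ∨ N = 3) (m₁ m₂ ω : ℝ) {v : H1Pair N}
    (hv : ∀ h : H1Pair N,
      quadVar ((m₁ ^ 2 - ω ^ 2) / 2) ((m₂ ^ 2 - 4 * ω ^ 2) / 2) v h = GVar v h) :
    HasFDerivAt (Jom m₁ m₂ ω) (0 : H1Pair N →L[ℝ] ℝ) v := by
  obtain ⟨C, -, hbd⟩ := exists_abs_remainder_le hN ((m₁ ^ 2 - ω ^ 2) / 2)
    ((m₂ ^ 2 - 4 * ω ^ 2) / 2) v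
  refine hasFDerivAt_zero_of_quadratic_bound (C := C) fun h hh => ?_
  have hGa : G (v + h) = G v + GVar v h + GVarTwo v h + G h := G_add hN v h
  have e : Jom m₁ m₂ ω (v + h) - Jom m₁ m₂ ω v
      = quad ((m₁ ^ 2 - ω ^ 2) / 2) ((m₂ ^ 2 - 4 * ω ^ 2) / 2) h - GVarTwo v h - G h := by
    rw [Jom_eq, Jom_eq, quad_add, hGa, hv h]
    ring
  rw [e]
  refine le_trans ?_ (hbd h hh)
  refine (abs_sub _ _).trans ?_
  gcongr
  exact abs_sub _ _

theorem two_mul_eq_three_mul_of_hasDerivAt {q g : ℝ}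
    (h : HasDerivAt (fun s : ℝ => s ^ 2 * q - s ^ 3 * g) 0 1) : 2 * q = 3 * g := by
  have d2 := (((hasDerivAt_id (1 : ℝ)).pow 2).mul_const q).sub
      (((hasDerivAt_id (1 : ℝ)).pow 3).mul_const g)
  have := h.unique d2
  simp at this
  linarith

/-- Critical points of `J_ω` satisfy `2 quad = 3 G`. -/
theorem two_quad_eq_three_G {m₁ m₂ ω : ℝ} {φ : H1Pair N}
    (h : HasFDerivAt (Jom m₁ m₂ ω) (0 : H1Pair N →L[ℝ] ℝ) φ) :
    2 * quad ((m₁ ^ 2 - ω ^ 2) / 2) ((m₂ ^ 2 - 4 * ω ^ 2) / 2) φ = 3 * G φ := by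
  have d1 := hasDerivAt_ray_of_hasFDerivAt_zero h
  have e : (fun s : ℝ => Jom m₁ m₂ ω (s • φ))
      = fun s : ℝ => s ^ 2 * quad ((m₁ ^ 2 - ω ^ 2) / 2) ((m₂ ^ 2 - 4 * ω ^ 2) / 2) φ
        - s ^ 3 * G φ := by
    ext s
    rw [Jom_eq, quad_smul, G_smul]
  rw [e] at d1
  exact two_mul_eq_three_mul_of_hasDerivAt d1

/-- Scaling the maximizer by s multiplies both sides of its inequality by s⁶, so s is free and can
be fixed by 2 s² `quad` = 3 s³ G. -/
theorem exists_normalized_maximizer (hN : N = 2 ∨ N = 3) {c₁ c₂ : ℝ} (h₁ : 0 < c₁) (h₂ : 0 < c₂)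
    {u₀ : H1Pair N} (hu₀ : 0 < G u₀) : ∃ v : H1Pair N, 0 < G v ∧ 2 * quad c₁ c₂ v = 3 * G v ∧
      ∀ w : H1Pair N, G w ^ 2 * quad c₁ c₂ v ^ 3 ≤ G v ^ 2 * quad c₁ c₂ w ^ 3 := by
  obtain ⟨v₀, hG0, hQ0, hmax0⟩ := exists_maximizer hN h₁ h₂ hu₀
  obtain ⟨s, hs⟩ : ∃ s : ℝ, s = 2 * quad c₁ c₂ v₀ / (3 * G v₀) := ⟨_, rfl⟩
  have hs0 : 0 < s := by rw [hs]; positivity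
  refine ⟨s • v₀, ?_, ?_, fun w => ?_⟩
  · rw [G_smul]; positivity
  · rw [G_smul, quad_smul, hs]; field_simp
  · rw [G_smul, quad_smul]
    have := mul_le_mul_of_nonneg_left (hmax0 w) (show 0 ≤ s ^ 6 by positivity)
    linarith

/-- Under the normalization the action is q/3 and the quotient q³/g² is 9q/4. Smaller action
therefore gives a smaller quotient, and minimality passes from (Q, G') to (q, g). -/
theorem sq_mul_cube_le_of_normalized {q g Q G' x y : ℝ} (hq : 0 < q) (h₁ : 2 * q = 3 * g)
    (h₂ : 2 * Q = 3 * G') (hle : q - g ≤ Q - G') (hm : x ^ 2 * Q ^ 3 ≤ G' ^ 2 * y ^ 3) :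
    x ^ 2 * q ^ 3 ≤ g ^ 2 * y ^ 3 := by
  have e1 : G' = 2 / 3 * Q := by linarith
  have e2 : g = 2 / 3 * q := by linarith
  have hqQ : q ≤ Q := by linarith
  have hQ : 0 < Q := by linarith
  rw [e1] at hm
  rw [e2]
  have hm' : x ^ 2 * Q ≤ 4 / 9 * y ^ 3 := by
    have : Q ^ 2 * (x ^ 2 * Q) ≤ Q ^ 2 * (4 / 9 * y ^ 3) := by linarith
    exact le_of_mul_le_mul_left this (by positivity)
  have h4 : x ^ 2 * q ≤ x ^ 2 * Q := by gcongr
  have := mul_le_mul_of_nonneg_left (h4.trans hm') (sq_nonneg q)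
  linarith

/-- A ground state minimizes `quad³ / G²`. -/
theorem groundState_minimizes (hN : N = 2 ∨ N = 3) {m₁ m₂ ω : ℝ}
    (h₁ : 0 < (m₁ ^ 2 - ω ^ 2) / 2) (h₂ : 0 < (m₂ ^ 2 - 4 * ω ^ 2) / 2) {φ : H1Pair N}
    (hφ : φ ∈ groundStates N m₁ m₂ ω) (w : H1Pair N) :
    G w ^ 2 * quad ((m₁ ^ 2 - ω ^ 2) / 2) ((m₂ ^ 2 - 4 * ω ^ 2) / 2) φ ^ 3
      ≤ G φ ^ 2 * quad ((m₁ ^ 2 - ω ^ 2) / 2) ((m₂ ^ 2 - 4 * ω ^ 2) / 2) w ^ 3 := by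
  obtain ⟨⟨hφ0, hφc⟩, hmin⟩ := hφ
  have hN1 := two_quad_eq_three_G hφc
  have hQφ := quad_pos h₁ h₂ hφ0
  have hGφ : 0 < G φ := by linarith
  obtain ⟨v, hGv, hnorm, hmax⟩ := exists_normalized_maximizer hN h₁ h₂ hGφ
  have hvne : v ≠ 0 := by
    intro h0; rw [h0, G_zero] at hGv; exact lt_irrefl _ hGv
  have hle := hmin v ⟨hvne, hasFDerivAt_Jom_zero hN m₁ m₂ ω
    fun h => quadVar_eq_GVar hN hGv hnorm hmax h⟩
  rw [Jom_eq, Jom_eq] at hle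
  exact sq_mul_cube_le_of_normalized hQφ hN1 hnorm hle (hmax w)

/-! ### Consequences of dilation: real-variable inequalities. -/

/-- Equality holds at s = 1, so the derivative (m + g)² (6g - N(m + g)) of the difference vanishes
there. -/
theorem pohozaev_of_forall {m g : ℝ} (hpos : 0 < m + g)
    (h : ∀ s : ℝ, 0 < s → s ^ N * (m + g) ^ 3 ≤ (m + s ^ 2 * g) ^ 3) :
    6 * g = N * (m + g) := by
  let p : ℝ → ℝ := fun s => (m + s ^ 2 * g) ^ 3 - s ^ N * (m + g) ^ 3
  have hp1 : p 1 = 0 := by simp [p]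
  have hmin : IsLocalMin p 1 := by
    filter_upwards [lt_mem_nhds (show (0 : ℝ) < 1 by norm_num)] with s hs
    rw [hp1]
    exact sub_nonneg.2 (h s hs)
  have id1 := hasDerivAt_id (1 : ℝ)
  have hd : HasDerivAt p _ 1 := ((((id1.pow 2).mul_const g).const_add m).pow 3).sub
    ((id1.pow N).mul_const ((m + g) ^ 3))
  have := hmin.hasDerivAt_eq_zero hd
  simp at this
  have h2 : (m + g) ^ 2 * (6 * g - N * (m + g)) = 0 := by linear_combination this
  have := (mul_eq_zero.1 h2).resolve_left (by positivity)
  linarith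

/-- The optimal choice s² = m/(2g) fails at g = 0; s² = 2m/(3l + g) agrees with it in the extremal
case g = l and is always defined. The loss is the square in (3l + g)² - 8l(l + g) = (l - g)². -/
theorem dilation_bound_two {m g l q : ℝ} (hm : 0 < m) (hg : 0 ≤ g) (hl : 0 < l)
    (h : ∀ s : ℝ, 0 < s → 27 / 8 * q * (s ^ 2 * (l + g) ^ 2) ≤ (m + s ^ 2 * g) ^ 3) :
    2 * l * q ≤ m ^ 2 := by
  set D := 3 * l + g with hD
  have hD0 : 0 < D := by positivity
  have ht : 0 < 2 * m / D := by positivity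
  have h1 := h (√(2 * m / D)) (Real.sqrt_pos.2 ht)
  rw [Real.sq_sqrt ht.le] at h1
  have e1 : m + 2 * m / D * g = 3 * m * (l + g) / D := by
    rw [hD]; field_simp; ring
  rw [e1] at h1
  have e2 : (3 * m * (l + g) / D) ^ 3 * D ^ 3 = 27 * m ^ 3 * (l + g) ^ 3 := by field_simp; norm_num
  have e3 : 27 / 8 * q * (2 * m / D * (l + g) ^ 2) * D ^ 3
      = 27 / 4 * m * (l + g) ^ 2 * (q * D ^ 2) := by field_simp; ring
  have h2 := mul_le_mul_of_nonneg_right h1 (pow_pos hD0 3).le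
  rw [e2, e3] at h2
  have h3 : 27 / 4 * m * (l + g) ^ 2 * (q * D ^ 2)
      ≤ 27 / 4 * m * (l + g) ^ 2 * (4 * m ^ 2 * (l + g)) := by linarith
  have h4 : q * D ^ 2 ≤ 4 * m ^ 2 * (l + g) := le_of_mul_le_mul_left h3 (by positivity)
  have h5 : D ^ 2 * (2 * l * q) ≤ D ^ 2 * m ^ 2 := by
    have k1 : 2 * l * (q * D ^ 2) ≤ 2 * l * (4 * m ^ 2 * (l + g)) := by gcongr
    have k2 : 0 ≤ m ^ 2 * (l - g) ^ 2 := by positivity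
    rw [hD] at *
    linarith
  exact le_of_mul_le_mul_left h5 (by positivity)

/-- The same s² = 2m/(3l + g) agrees with the optimal m/g in the extremal case g = 3l. The loss is
(3l + g)³ - (27/2) l (l + g)² = (g - 3l)² (g + 3l/2). Squaring removes the odd power of s. -/
theorem dilation_bound_three {m g l q : ℝ} (hm : 0 < m) (hg : 0 ≤ g) (hl : 0 < l) (hq : 0 ≤ q)
    (h : ∀ s : ℝ, 0 < s → 9 / 2 * q * (s ^ 3 * (l + g) ^ 2) ≤ (m + s ^ 2 * g) ^ 3) :
    3 * l * q ^ 2 ≤ m ^ 3 := by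
  set D := 3 * l + g with hD
  have hD0 : 0 < D := by positivity
  have ht : 0 < 2 * m / D := by positivity
  have hs : 0 < √(2 * m / D) := Real.sqrt_pos.2 ht
  have h1 := h (√(2 * m / D)) hs
  have h1' := pow_le_pow_left₀ (by positivity) h1 2
  have e0 : (9 / 2 * q * (√(2 * m / D) ^ 3 * (l + g) ^ 2)) ^ 2
      = 81 / 4 * q ^ 2 * ((√(2 * m / D) ^ 2) ^ 3 * (l + g) ^ 4) := by ring
  rw [e0, Real.sq_sqrt ht.le] at h1'
  have e1 : m + 2 * m / D * g = 3 * m * (l + g) / D := by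
    rw [hD]; field_simp; ring
  rw [e1] at h1'
  have e2 : ((3 * m * (l + g) / D) ^ 3) ^ 2 * D ^ 6 = 729 * m ^ 6 * (l + g) ^ 6 := by
    field_simp; norm_num
  have e3 : 81 / 4 * q ^ 2 * ((2 * m / D) ^ 3 * (l + g) ^ 4) * D ^ 6
      = 162 * m ^ 3 * (l + g) ^ 4 * (q ^ 2 * D ^ 3) := by field_simp; ring
  have h2 := mul_le_mul_of_nonneg_right h1' (pow_pos hD0 6).le
  rw [e2, e3] at h2
  have h3 : 162 * m ^ 3 * (l + g) ^ 4 * (q ^ 2 * D ^ 3)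
      ≤ 162 * m ^ 3 * (l + g) ^ 4 * (9 / 2 * m ^ 3 * (l + g) ^ 2) := by linarith
  have h4 : q ^ 2 * D ^ 3 ≤ 9 / 2 * m ^ 3 * (l + g) ^ 2 :=
    le_of_mul_le_mul_left h3 (by positivity)
  have h5 : D ^ 3 * (3 * l * q ^ 2) ≤ D ^ 3 * m ^ 3 := by
    have k1 : 3 * l * (q ^ 2 * D ^ 3) ≤ 3 * l * (9 / 2 * m ^ 3 * (l + g) ^ 2) := by gcongr
    have k2 : 0 ≤ m ^ 3 * ((g - 3 * l) ^ 2 * (g + 3 / 2 * l)) := by positivity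
    rw [hD] at *
    linarith
  exact le_of_mul_le_mul_left h5 (by positivity)

/-- The concluding inequality in dimension two, `x` being the square of the scaling factor. -/
theorem final_bound_two {k kφ q m l n : ℝ} (hm : 0 < m) (hl : 0 < l) (hx : m < 2 * l)
    (hq : 2 * l * q ≤ m ^ 2) (hSC : 2 * kφ ≤ q) (hH : m + n ≤ k + 2 * l)
    (hQ : ∀ y : ℝ, 0 < y → 2 * kφ ≤ y⁻¹ * k + y * n) :
    2 * kφ + q / 2 ≤ 2 * k + l := by
  obtain ⟨x, rfl⟩ : ∃ x, m = 2 * l * x := ⟨m / (2 * l), by field_simp⟩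
  have hx0 : 0 < x := by
    by_contra hn
    nlinarith
  have hx1 : x < 1 := by nlinarith
  have hq' : q ≤ 2 * l * x ^ 2 := by
    have : 2 * l * q ≤ 2 * l * (2 * l * x ^ 2) := by linarith
    exact le_of_mul_le_mul_left this (by positivity)
  have hx2 : x ^ 2 < x := by nlinarith
  have hlx : l * x ^ 2 ≤ l * x := by gcongr
  have hlx' : l * x ≤ l := by nlinarith
  rcases le_total kφ k with hk | hk
  · linarith
  -- Now k ≤ kφ ≤ q/2 ≤ lx², so k/x ≤ l. Since (1-x)² k/x = k/x + xk - 2k, the charge inequality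
  -- with weight x gives 2kφ ≤ 2k + l(1 - x²), and q/2 ≤ lx² fills the gap.
  · have h1 := hQ x hx0
    have h2 : x * n ≤ x * (k + 2 * l - 2 * l * x) := by
      gcongr; linarith
    have hkx : x⁻¹ * k ≤ l := by
      rw [inv_mul_le_iff₀ hx0]; linarith
    have h3 : (1 - x) ^ 2 * (x⁻¹ * k) ≤ (1 - x) ^ 2 * l := by gcongr
    have e : (1 - x) ^ 2 * (x⁻¹ * k) = x⁻¹ * k + x * k - 2 * k := by field_simp; ring
    nlinarith

/-- The concluding inequality in dimension three, `x` being the scaling factor. -/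
theorem final_bound_three {k kφ q m l n : ℝ} (hm : 0 < m) (hl : 0 < l) (hx : m < 3 * l)
    (hq : 3 * l * q ^ 2 ≤ m ^ 3) (hSC : kφ ≤ q) (hH : m + n ≤ k + 3 * l)
    (hQ : ∀ y : ℝ, 0 < y → 2 * kφ ≤ y⁻¹ * k + y * n) :
    2 * kφ + 2 / 3 * q ≤ 2 * k + 2 * l := by
  obtain ⟨x, hx0, rfl⟩ : ∃ x, 0 < x ∧ m = 3 * l * x ^ 2 :=
    ⟨√(m / (3 * l)), Real.sqrt_pos.2 (by positivity), by
      rw [Real.sq_sqrt (by positivity)]; field_simp⟩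
  have hx1 : x < 1 := by
    have : x ^ 2 < 1 := by nlinarith
    nlinarith
  have hq' : q ≤ 3 * l * x ^ 3 := by
    have : 3 * l * q ^ 2 ≤ 3 * l * (3 * l * x ^ 3) ^ 2 := by linarith
    exact le_of_sq_le_sq (le_of_mul_le_mul_left this (by positivity)) (by positivity)
  have hx2 : x ^ 2 ≤ x := by nlinarith
  have hx3 : x ^ 3 ≤ x ^ 2 := by nlinarith
  rcases le_total kφ k with hk | hk
  · have : l * x ^ 3 ≤ l * 1 := by gcongr; linarith
    linarith
  -- Now k ≤ kφ ≤ q ≤ 3lx³, so k/x ≤ 3lx² ≤ l(2 + x). As (1-x)²(2 + x) = 2 - 3x + x³, weight x gives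
  -- 2kφ ≤ 2k + 2l - 2lx³, and 2q/3 ≤ 2lx³ fills the gap.
  · have h1 := hQ x hx0
    have h2 : x * n ≤ x * (k + 3 * l - 3 * l * x ^ 2) := by
      gcongr; linarith
    have hkx : x⁻¹ * k ≤ l * (2 + x) := by
      rw [inv_mul_le_iff₀ hx0]
      have : 3 * x ^ 2 ≤ 2 + x := by nlinarith
      have : l * x * (3 * x ^ 2) ≤ l * x * (2 + x) := by gcongr
      linarith
    have h3 : (1 - x) ^ 2 * (x⁻¹ * k) ≤ (1 - x) ^ 2 * (l * (2 + x)) := by gcongr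
    have e : (1 - x) ^ 2 * (x⁻¹ * k) = x⁻¹ * k + x * k - 2 * k := by field_simp; ring
    nlinarith

/-- Ground states satisfy a dilation-invariant Gagliardo--Nirenberg inequality. -/
theorem groundState_dilation (hN : N = 2 ∨ N = 3) {m₁ m₂ ω : ℝ}
    (h₁ : 0 < (m₁ ^ 2 - ω ^ 2) / 2) (h₂ : 0 < (m₂ ^ 2 - 4 * ω ^ 2) / 2) {φ : H1Pair N}
    (hφ : φ ∈ groundStates N m₁ m₂ ω) (w : H1Pair N) {s : ℝ} (hs : 0 < s) :
    s ^ N * G w ^ 2 * quad ((m₁ ^ 2 - ω ^ 2) / 2) ((m₂ ^ 2 - 4 * ω ^ 2) / 2) φ ^ 3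
      ≤ G φ ^ 2
        * (Mom m₁ m₂ ω w + s ^ 2 * (1 / 2 * (‖grad w.1‖ ^ 2 + ‖grad w.2‖ ^ 2))) ^ 3 := by
  obtain ⟨z, -, -, f₁, f₂, g₁, g₂, hG⟩ := exists_affine_pair w hs 0
  have h := groundState_minimizes hN h₁ h₂ hφ z
  have e : quad ((m₁ ^ 2 - ω ^ 2) / 2) ((m₂ ^ 2 - 4 * ω ^ 2) / 2) z = (s ^ N)⁻¹ *
      (Mom m₁ m₂ ω w + s ^ 2 * (1 / 2 * (‖grad w.1‖ ^ 2 + ‖grad w.2‖ ^ 2))) := by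
    rw [quad, f₁, f₂, g₁, g₂, Mom]; ring
  rw [e, hG] at h
  have hsN : 0 < s ^ N := by positivity
  have := mul_le_mul_of_nonneg_left h (pow_pos hsN 3).le
  have k1 (a b : ℝ) : (s ^ N) ^ 3 * (((s ^ N)⁻¹ * a) ^ 2 * b) = s ^ N * a ^ 2 * b := by
    field_simp
  have k2 (a b : ℝ) : (s ^ N) ^ 3 * (a * ((s ^ N)⁻¹ * b) ^ 3) = a * b ^ 3 := by
    field_simp
  rwa [k1, k2] at this

/-! ### Charge, energy and the conclusion. -/

theorem l2Inner_eq_re_inner (f g : L2 N) : l2Inner f g = (inner ℂ g f : ℂ).re := by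
  rw [l2Inner, L2.inner_def]
  simp only [RCLike.inner_apply]

theorem abs_l2Inner_I_smul_le (f g : L2 N) : |l2Inner f (Complex.I • g)| ≤ ‖f‖ * ‖g‖ := by
  rw [l2Inner_eq_re_inner]
  refine (Complex.abs_re_le_norm _).trans ((norm_inner_le_norm _ _).trans (le_of_eq ?_))
  rw [norm_smul, Complex.norm_I, one_mul, mul_comm]

theorem l2Inner_I_smul_self (c : ℝ) (f : L2 N) :
    l2Inner ((Complex.I * c) • f) (Complex.I • f) = c * ‖f‖ ^ 2 := by
  rw [l2Inner_eq_re_inner, inner_smul_left, inner_smul_right, inner_self_eq_norm_sq_to_K,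
    Complex.conj_I]
  have : -Complex.I * (Complex.I * c * ((‖f‖ : ℝ) : ℂ) ^ 2) = ((c * ‖f‖ ^ 2 : ℝ) : ℂ) := by
    push_cast
    linear_combination (-(c : ℂ) * (‖f‖ : ℂ) ^ 2) * Complex.I_sq
  have h2 := congrArg Complex.re this
  rw [Complex.ofReal_re] at h2
  exact h2

theorem mul_le_weighted {a b y : ℝ} (hy : 0 < y) : a * b ≤ 1 / 2 * (y⁻¹ * a ^ 2 + y * b ^ 2) := by
  have h : 0 ≤ y⁻¹ * (a - y * b) ^ 2 := by positivity
  have e : y⁻¹ * (a - y * b) ^ 2 = y⁻¹ * a ^ 2 - 2 * (a * b) + y * b ^ 2 := by field_simp; ring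
  linarith

/-- Cauchy–Schwarz and Young with a free weight y, later set to the number x of the concluding
inequalities. Passing to |ω| covers both signs of ω. -/
theorem mul_Q_le (ω : ℝ) (u : H1Pair N) (v : L2Pair N) {y : ℝ} (hy : 0 < y) :
    ω * Q (u, v) ≤ y⁻¹ * K v
      + y * (ω ^ 2 * (1 / 2 * (‖fn u.1‖ ^ 2 + 4 * ‖fn u.2‖ ^ 2))) := by
  have b1 := abs_l2Inner_I_smul_le v.1 (fn u.1)
  have b2 := abs_l2Inner_I_smul_le v.2 (fn u.2)
  have w1 := mul_le_weighted (a := ‖v.1‖) (b := |ω| * ‖fn u.1‖) hy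
  have w2 := mul_le_weighted (a := ‖v.2‖) (b := |ω| * (2 * ‖fn u.2‖)) hy
  have c1 : ω * l2Inner v.1 (Complex.I • fn u.1) ≤ ‖v.1‖ * (|ω| * ‖fn u.1‖) := by
    refine (le_abs_self _).trans ?_
    rw [abs_mul]
    calc |ω| * |l2Inner v.1 (Complex.I • fn u.1)| ≤ |ω| * (‖v.1‖ * ‖fn u.1‖) := by gcongr
      _ = _ := by ring
  have c2 : ω * (2 * l2Inner v.2 (Complex.I • fn u.2)) ≤ ‖v.2‖ * (|ω| * (2 * ‖fn u.2‖)) := by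
    refine (le_abs_self _).trans ?_
    rw [abs_mul, abs_mul, abs_two]
    calc |ω| * (2 * |l2Inner v.2 (Complex.I • fn u.2)|) ≤ |ω| * (2 * (‖v.2‖ * ‖fn u.2‖)) := by
          gcongr
      _ = _ := by ring
  rw [mul_pow, sq_abs] at w1 w2
  simp only [Q, K]
  linarith

theorem Q_velocity (ω : ℝ) (φ : H1Pair N) :
    Q (φ, velocity ω φ) = ω * (‖fn φ.1‖ ^ 2 + 4 * ‖fn φ.2‖ ^ 2) := by
  have e : (2 * Complex.I * ω) = Complex.I * ((2 * ω : ℝ) : ℂ) := by push_cast; ring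
  simp only [Q, velocity]
  rw [e, l2Inner_I_smul_self, l2Inner_I_smul_self]
  ring

theorem norm_sq_velocity (ω : ℝ) (φ : H1Pair N) :
    ‖(velocity ω φ).1‖ ^ 2 = ω ^ 2 * ‖fn φ.1‖ ^ 2 ∧
      ‖(velocity ω φ).2‖ ^ 2 = 4 * ω ^ 2 * ‖fn φ.2‖ ^ 2 := by
  simp only [velocity, norm_smul, norm_mul, Complex.norm_I, Complex.norm_real, Real.norm_eq_abs,
    mul_pow, sq_abs, RCLike.norm_ofNat]
  constructor <;> ring

theorem G_eq_zero_of_fn_eq_zero {u : H1Pair N} (h : fn u.1 = 0) : G u = 0 := by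
  have h0 : (fn u.1) =ᵐ[volume] 0 := by rw [h]; exact Lp.coeFn_zero _ _ _
  have : ∫ x, (fn u.1 x) ^ 2 * conj (fn u.2 x) = ∫ _ : Space N, (0 : ℂ) := by
    apply integral_congr_ae
    filter_upwards [h0] with x hx
    simp [hx]
  rw [G, this]; simp

theorem Mom_pos {m₁ m₂ ω : ℝ} (h₁ : 0 < (m₁ ^ 2 - ω ^ 2) / 2)
    (h₂ : 0 < (m₂ ^ 2 - 4 * ω ^ 2) / 2) {u : H1Pair N} (hG : G u ≠ 0) : 0 < Mom m₁ m₂ ω u := by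
  have k2 : 0 ≤ (m₂ ^ 2 - 4 * ω ^ 2) / 2 * ‖fn u.2‖ ^ 2 := by positivity
  have hne : fn u.1 ≠ 0 := fun h => hG (G_eq_zero_of_fn_eq_zero h)
  have k1 : 0 < (m₁ ^ 2 - ω ^ 2) / 2 * ‖fn u.1‖ ^ 2 := by
    have := norm_pos_iff.2 hne
    positivity
  exact add_pos_of_pos_of_nonneg k1 k2

theorem M_eq_Mom_add (m₁ m₂ ω : ℝ) (u : H1Pair N) : M m₁ m₂ u = Mom m₁ m₂ ω u
    + ω ^ 2 * (1 / 2 * (‖fn u.1‖ ^ 2 + 4 * ‖fn u.2‖ ^ 2)) := by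
  simp only [M, Mom]; ring

theorem G_eq_L_add (u : H1Pair N) :
    G u = L u + 1 / 2 * (‖grad u.1‖ ^ 2 + ‖grad u.2‖ ^ 2) := by
  simp only [L]; ring

theorem E_eq (m₁ m₂ : ℝ) (u : H1Pair N) (v : L2Pair N) :
    E m₁ m₂ (u, v) = K v + M m₁ m₂ u - L u := by
  simp only [E, K, M, L]; ring

theorem E_velocity (m₁ m₂ ω : ℝ) (φ : H1Pair N) :
    E m₁ m₂ (φ, velocity ω φ) = ω ^ 2 * (‖fn φ.1‖ ^ 2 + 4 * ‖fn φ.2‖ ^ 2)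
      + (Mom m₁ m₂ ω φ + 1 / 2 * (‖grad φ.1‖ ^ 2 + ‖grad φ.2‖ ^ 2)) - G φ := by
  obtain ⟨n1, n2⟩ := norm_sq_velocity ω φ
  simp only [E, Mom, n1, n2]; ring

/-- The inequality between the numerical invariants of a ground state (`q`, `gφ`, `γ`, `κ`) and of
a competitor (`m`, `g`, `l`, `n`, `k`). -/
theorem energy_bound (hN : N = 2 ∨ N = 3) {q gφ γ κ m g l n k : ℝ} (hquad : 0 < q + gφ)
    (hneh : 2 * (q + gφ) = 3 * γ)
    (hdilφ : ∀ s : ℝ, 0 < s → s ^ N * γ ^ 2 * (q + gφ) ^ 3 ≤ γ ^ 2 * (q + s ^ 2 * gφ) ^ 3)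
    (hdil : ∀ s : ℝ, 0 < s → s ^ N * (l + g) ^ 2 * (q + gφ) ^ 3 ≤ γ ^ 2 * (m + s ^ 2 * g) ^ 3)
    (hSC : 0 ≤ 2 * q - (4 - (N : ℝ)) * κ) (hm : 0 < m) (hg : 0 ≤ g) (hl : 0 < l)
    (hH : -alpha N * k + alpha N * (m + n) - (alpha N + 2) * l ≤ 0)
    (hP : alpha N * m - (alpha N + 2) * l < 0)
    (hQ : ∀ y : ℝ, 0 < y → 2 * (κ / 2) ≤ y⁻¹ * k + y * n) :
    alpha N * (κ + (q + gφ) - γ) ≤ alpha N * (k + (m + n) - l)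
      - (-alpha N * k + alpha N * (m + n) - (alpha N + 2) * l) := by
  -- In the application q = M_ω(φ), gφ is half the squared gradient norm of φ, γ = G(φ) and κ =
  -- 2K(ψ); for the competitor m = M_ω(u), g is the gradient part, l = L(u), n = M(u) - M_ω(u) and k
  -- = K(v).
  have hγ0 : 0 < γ := by linarith
  have hpoh : 6 * gφ = N * (q + gφ) := by
    refine pohozaev_of_forall hquad fun s hs => ?_
    have := hdilφ s hs
    have hG2 : 0 < γ ^ 2 := by positivity
    exact le_of_mul_le_mul_left (by linarith) hG2
  unfold alpha at *
  rcases hN with rfl | rfl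
  -- For N = 2 the Pohozaev identity and the normalization give gφ = q/2 and γ = q.
  · norm_num at hpoh hSC hH hP ⊢
    have hgφ : gφ = q / 2 := by linarith
    subst hgφ
    have hγ : γ = q := by linarith
    subst hγ
    have key : 2 * l * γ ≤ m ^ 2 := by
      refine dilation_bound_two hm hg hl fun s hs => ?_
      have := hdil s hs
      have h2 : 0 < γ ^ 2 := by positivity
      exact le_of_mul_le_mul_left (by linarith) h2
    have := final_bound_two (k := k) (kφ := κ / 2) (n := n) hm hl (by linarith) key
      (by linarith) (by linarith) hQ
    linarith
  -- For N = 3 they give gφ = q and γ = 4q/3.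
  · norm_num at hpoh hSC hH hP ⊢
    have hgφ : gφ = q := by linarith
    subst hgφ
    have hγ : γ = 4 / 3 * gφ := by linarith
    subst hγ
    have hq0 : 0 < gφ := by linarith
    have key : 3 * l * gφ ^ 2 ≤ m ^ 3 := by
      refine dilation_bound_three hm hg hl hq0.le fun s hs => ?_
      have := hdil s hs
      have h2 : 0 < 16 / 9 * gφ ^ 2 := by positivity
      exact le_of_mul_le_mul_left (by linarith) h2
    have := final_bound_three (k := k) (kφ := κ / 2) (n := n) hm hl (by linarith) key
      (by linarith) (by linarith) hQ
    linarith

end KleinGordon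

end

theorem proposition4 (N : ℕ) (hN : N = 2 ∨ N = 3) (m₁ m₂ ω : ℝ) (hm₁ : 0 < m₁) (hm₂ : 0 < m₂)
    (hω : ω ^ 2 < min (m₁ ^ 2) (m₂ ^ 2 / 4))
    (φ : H1Pair N) (hφ : φ ∈ groundStates N m₁ m₂ ω)
    (hrad₁ : IsRadial (fn φ.1)) (hrad₂ : IsRadial (fn φ.2))
    (hSC : 0 ≤ (m₁ ^ 2 - (5 - (N : ℝ)) * ω ^ 2) * ‖fn φ.1‖ ^ 2
      + (m₂ ^ 2 - 4 * (5 - (N : ℝ)) * ω ^ 2) * ‖fn φ.2‖ ^ 2)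
    (u : H1Pair N) (v : L2Pair N)
    (hH : KleinGordon.H m₁ m₂ (u, v) ≤ 0)
    (hQ : KleinGordon.Q (u, v) = KleinGordon.Q (φ, velocity ω φ))
    (hP : Pom m₁ m₂ ω u < 0) :
    alpha N * KleinGordon.E m₁ m₂ (φ, velocity ω φ)
      ≤ alpha N * KleinGordon.E m₁ m₂ (u, v) - KleinGordon.H m₁ m₂ (u, v) := by
  have h₁ : 0 < (m₁ ^ 2 - ω ^ 2) / 2 := by
    have := hω.trans_le (min_le_left _ _); linarith
  have h₂ : 0 < (m₂ ^ 2 - 4 * ω ^ 2) / 2 := by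
    have := hω.trans_le (min_le_right _ _); linarith
  have hHu : KleinGordon.H m₁ m₂ (u, v)
      = -alpha N * K v + alpha N * M m₁ m₂ u - (alpha N + 2) * L u := rfl
  have hPu : alpha N * Mom m₁ m₂ ω u - (alpha N + 2) * L u < 0 := hP
  have hmu0 : 0 ≤ Mom m₁ m₂ ω u := by unfold Mom; positivity
  have hg0 : 0 ≤ 1 / 2 * (‖grad u.1‖ ^ 2 + ‖grad u.2‖ ^ 2) := by positivity
  -- P_ω(u) < 0 and M_ω(u) ≥ 0 force L(u) > 0; then G(u) > 0, so u₁ ≠ 0 and M_ω(u) > 0.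
  have hl : 0 < L u := by
    have hα : 0 < alpha N := by unfold alpha; rcases hN with rfl | rfl <;> norm_num
    have := mul_nonneg hα.le hmu0
    exact pos_of_mul_pos_right (by linarith : 0 < (alpha N + 2) * L u) (by linarith)
  have hGL := G_eq_L_add u
  have hm : 0 < Mom m₁ m₂ ω u := Mom_pos h₁ h₂ (by rw [hGL]; positivity)
  have hdil := fun (s : ℝ) (hs : 0 < s) => groundState_dilation hN h₁ h₂ hφ u hs
  rw [hGL] at hdil
  rw [hHu, M_eq_Mom_add m₁ m₂ ω u] at hH
  rw [E_velocity, E_eq, hHu, M_eq_Mom_add m₁ m₂ ω u]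
  refine energy_bound hN (quad_pos h₁ h₂ hφ.1.1) (two_quad_eq_three_G hφ.1.2)
    (fun s hs => groundState_dilation hN h₁ h₂ hφ φ hs) hdil ?_ hm hg0 hl hH hPu fun y hy => ?_
  -- The assumption on φ reads 2 M_ω(φ) ≥ (4 - N) κ with κ = ω²(‖φ₁‖² + 4‖φ₂‖²).
  · refine hSC.trans (le_of_eq ?_)
    simp only [Mom]; ring
  -- The prescribed charge enters only here, through ω Q(φ, ψ) = κ.
  · have h := mul_Q_le ω u v hy
    rw [hQ, Q_velocity] at h
    linarith
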